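/- Throughout, $\mathbb F_2$ is the field with two elements, $[d]=\{1,\dots,d\}$, and for $I\subset[d]$ we write $\mathbb F_2^I=\bigotimes_{i\in I}\mathbb F_2^{n_i}$ and $I^c=[d]\setminus I$, so that $\mathbb F_2^{n_1}\otimes\dots\otimes\mathbb F_2^{n_d}=\mathbb F_2^I\otimes\mathbb F_2^{I^c}$ (for $I=[d]$, $H\otimes\mathbb F_2^{\emptyset}$ is just $H$). A set $\mathcal A\subset\mathbb F_2^{n_1}\otimes\dots\otimes\mathbb F_2^{n_d}$ is called $\eta$-closed if, when $A\in\mathcal A$ and $u_i\in\mathbb F_2^{n_i}\setminus\{0\}$ ($1\le i\le d$) are chosen independently and uniformly at random, $A+u_1\otimes\dots\otimes u_d\in\mathcal A$ with probability at least $\eta$. For every real $\eta>0$ and every positive integer $d$ there is a $k=k(d,\eta)\in\mathbb N$ with the following property. For all positive integers $n_1,\dots,n_d$, if $V\subset\mathbb F_2^{n_1}\otimes\dots\otimes\mathbb F_2^{n_d}$ is an $\eta$-closed subspace, then there are subspaces $H_I\subset\mathbb F_2^I$ of codimension at most $k$, one for each non-empty $I\subset[d]$, such that $$\bigcap_{\emptyset\ne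 I\subset[d]}\bigl(H_I\otimes\mathbb F_2^{I^c}\bigr)\subset V.$$ That is, $V$ contains a $k$-simple subspace, where a $k$-simple subspace is an intersection of the above form. -/

import Mathlib

open scoped TensorProduct

namespace TensorClosed

/-- The vector space `𝔽₂ⁿ`. -/
abbrev Vec (n : ℕ) : Type := Fin n → ZMod 2

/-- The tensor product `𝔽₂^{n₁} ⊗ ⋯ ⊗ 𝔽₂^{n_d}`. -/
abbrev Tensors {d : ℕ} (n : Fin d → ℕ) : Type := ⨂[ZMod 2] i : Fin d, Vec (n i)

/-- The partial tensor product `𝔽₂^I`, the tensor product of the factors with index in `I`. -/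
abbrev TensorsOn {d : ℕ} (n : Fin d → ℕ) (I : Finset (Fin d)) : Type :=
  ⨂[ZMod 2] i : {i : Fin d // i ∈ I}, Vec (n i)

/-- The partial tensor product `𝔽₂^{Iᶜ}`, the tensor product of the factors with index not in `I`
(a one-dimensional space if `I` is everything). -/
abbrev TensorsOff {d : ℕ} (n : Fin d → ℕ) (I : Finset (Fin d)) : Type :=
  ⨂[ZMod 2] i : {i : Fin d // i ∉ I}, Vec (n i)

/-- The tuples `(u₁, …, u_d)` of nonzero vectors `uᵢ ∈ 𝔽₂^{nᵢ}`. -/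
abbrev NonzeroTuple {d : ℕ} (n : Fin d → ℕ) : Type := (i : Fin d) → {v : Vec (n i) // v ≠ 0}

/-- `A` is `η`-closed: if `a ∈ A` and the nonzero vectors `uᵢ` are chosen independently and
uniformly at random, then `a + u₁ ⊗ ⋯ ⊗ u_d ∈ A` with probability at least `η`. The probability
is the number of favourable pairs `(a, u)` over the number of all pairs. -/
def IsEtaClosed {d : ℕ} {n : Fin d → ℕ} (η : ℝ) (A : Set (Tensors n)) : Prop :=
  η * (Nat.card (A × NonzeroTuple n) : ℝ) ≤
    (Nat.card {p : A × NonzeroTuple n //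
      (p.1 : Tensors n) + PiTensorProduct.tprod (ZMod 2) (fun i => (p.2 i : Vec (n i))) ∈ A} : ℝ)

/-- The natural identification `𝔽₂^I ⊗ 𝔽₂^{Iᶜ} = 𝔽₂^{n₁} ⊗ ⋯ ⊗ 𝔽₂^{n_d}`. -/
noncomputable def splitEquiv {d : ℕ} (n : Fin d → ℕ) (I : Finset (Fin d)) :
    (TensorsOn n I ⊗[ZMod 2] TensorsOff n I) ≃ₗ[ZMod 2] Tensors n :=
  (PiTensorProduct.tmulEquivDep (ZMod 2)
      (fun k : {i : Fin d // i ∈ I} ⊕ {i : Fin d // i ∉ I} =>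
        Vec (n (Equiv.sumCompl (fun i => i ∈ I) k)))).trans
    (PiTensorProduct.reindex (ZMod 2) (fun i : Fin d => Vec (n i))
      (Equiv.sumCompl (fun i => i ∈ I)).symm).symm

/-- The identification sends `(⊗_{i ∈ I} uᵢ) ⊗ (⊗_{i ∉ I} uᵢ)` to `u₁ ⊗ ⋯ ⊗ u_d`. -/
theorem splitEquiv_tprod {d : ℕ} (n : Fin d → ℕ) (I : Finset (Fin d))
    (u : (i : Fin d) → Vec (n i)) :
    splitEquiv n I
      ((PiTensorProduct.tprod (ZMod 2) (fun i : {i : Fin d // i ∈ I} => u i)) ⊗ₜ[ZMod 2]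
        (PiTensorProduct.tprod (ZMod 2) (fun i : {i : Fin d // i ∉ I} => u i))) =
      PiTensorProduct.tprod (ZMod 2) u := by
  refine (LinearEquiv.symm_apply_eq _).2 ?_
  refine Eq.trans ?_ (PiTensorProduct.reindex_tprod (R := ZMod 2)
    (Equiv.sumCompl (fun i => i ∈ I)).symm u).symm
  refine (PiTensorProduct.tmulEquivDep_apply (ZMod 2)
    (N := fun k : {i : Fin d // i ∈ I} ⊕ {i : Fin d // i ∉ I} =>
      Vec (n (Equiv.sumCompl (fun i => i ∈ I) k)))
    (fun i => u i) (fun i => u i)).trans ?_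
  congr 1
  funext k
  cases k <;> rfl

/-- The subspace `H ⊗ 𝔽₂^{Iᶜ}` of `𝔽₂^{n₁} ⊗ ⋯ ⊗ 𝔽₂^{n_d}`, for a subspace `H` of `𝔽₂^I`. -/
noncomputable def extend {d : ℕ} {n : Fin d → ℕ} (I : Finset (Fin d))
    (H : Submodule (ZMod 2) (TensorsOn n I)) : Submodule (ZMod 2) (Tensors n) :=
  (LinearMap.range (LinearMap.rTensor (TensorsOff n I) H.subtype)).map
    (splitEquiv n I : (TensorsOn n I ⊗[ZMod 2] TensorsOff n I) →ₗ[ZMod 2] Tensors n)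

/-- `W` is a `k`-simple subspace: the intersection, over the nonempty `I ⊆ [d]`, of subspaces
`H_I ⊗ 𝔽₂^{Iᶜ}`, where every `H_I ⊆ 𝔽₂^I` has codimension at most `k`. -/
def IsSimpleSubspace {d : ℕ} {n : Fin d → ℕ} (k : ℕ) (W : Submodule (ZMod 2) (Tensors n)) :
    Prop :=
  ∃ H : (I : Finset (Fin d)) → Submodule (ZMod 2) (TensorsOn n I),
    (∀ I : Finset (Fin d), I.Nonempty → Module.finrank (ZMod 2) (TensorsOn n I ⧸ H I) ≤ k) ∧
      W = ⨅ (I : Finset (Fin d)) (_ : I.Nonempty), extend I (H I)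

end TensorClosed

/-!
Let `V` be an `η`-closed subspace and let `Φ` send a tuple `u` to `u₁ ⊗ ⋯ ⊗ u_d` modulo `V`. This is
a multilinear map whose zero set has density at least `min η 1 / 2 ^ d`. Two facts about multilinear
maps over `𝔽₂` give the theorem. A variety is here the set of common zeros of boundedly many
multilinear forms, each in a nonempty set of the variables.

*A dense zero set of a multilinear map contains a variety of bounded codimension*
(`denseZeroBound`), by induction on the number of variables. Let `Z` be the zero set and `S` a
nonempty proper set of variables. Some fibre `{x_S | (x_S, k) ∈ Z}` is dense, and apart from an
arbitrarily small fraction `ε` of all points it consists of points over which the opposite fibre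
has density at least some `c(ε) > 0`. By induction the fibre contains a variety `W`, of codimension
independent of `ε`. Each `x ∈ W` is a sum of vertices of many cubes contained in `W`, so for small
`ε` of vertices with dense opposite fibres; by induction these contain varieties, and thus so does
the fibre over `x` (`DenseZeroBound.sections`). Now let `x` lie in all these varieties and be
annihilated by `s` random functionals of `Φ`. A fraction of the points `h`, bounded below
independently of `s`, satisfies `Φ (x_S, h) = 0` for all proper `S`, including `S = ∅`, whence
`Φ (x + h) = Φ x`. But a nonzero value of `Φ` is annihilated by all the functionals at a fraction
`2 ^ (-s)` of the points only. So `Φ x = 0` if `s` is large.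

*A form `φ` vanishing on a variety is a sum of products `a * b` in complementary sets of variables,
with `a` from a bounded list depending on the variety alone* (`vanishingBound`), by induction on the
number of variables and on the number of defining forms `ψ` that involve a variable `t`. If at some
point `x₀` of the variety cut out by the other forms the `ψ` are linearly independent functions of
`t`, then near `x₀` (where finitely many values are as at `x₀`) `φ` is a combination of the `ψ`; the
coefficient of `ψ` is a value of `φ` and does not vary with the variables of `ψ`, so that summing
over a cube based at `x₀` yields `φ = ∑ b_ψ * ψ` on a variety not involving `t`, and the difference
is dealt with by induction (`eq_sum_mul_of_isDualAt`). Otherwise a relation between the `ψ` persists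
near a suitable `x₀`, and summing it over a cube shows that one `ψ` can be replaced by forms
without `t`.

Applied to the forms `l ∘ Φ`, for functionals `l` vanishing on `V`, the two facts show that every
such `l` vanishes on the simple subspace given by the annihilators of the forms `a`.
-/

namespace TensorClosed

open Function Finset

/-! ### Multilinear functions of some of the coordinates -/

theorem add_add_cancel_two {M : Type*} [AddCommGroup M] [Module (ZMod 2) M] (x h : M) :
    x + h + h = x := by
  rw [add_assoc, ZModModule.add_self, add_zero]

section Multilinear

variable {ι : Type} [DecidableEq ι] {V : ι → Type} [∀ i, AddCommGroup (V i)]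
  {H : Type} [AddCommGroup H]

/-- A function on `∏ i, V i` is multilinear on `I` if it depends on the coordinates in `I` only and
is additive in each of them. Over `𝔽₂` additivity is linearity. All forms, whatever their variables,
are thus functions on the same space, and fixing some coordinates only shrinks `I`. -/
structure MultilinearOn (I : Finset ι) (f : (∀ i, V i) → H) : Prop where
  congr : ∀ x y, (∀ i ∈ I, x i = y i) → f x = f y
  add : ∀ i ∈ I, ∀ x a b, f (update x i (a + b)) = f (update x i a) + f (update x i b)

namespace MultilinearOn

variable {I J : Finset ι} {f g : (∀ i, V i) → H}

theorem update_of_notMem (hf : MultilinearOn I f) {i : ι} (hi : i ∉ I) (x : ∀ i, V i) (a : V i) :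
    f (update x i a) = f x :=
  hf.congr _ _ fun j hj => update_of_ne (by rintro rfl; exact hi hj) _ _

theorem update_zero (hf : MultilinearOn I f) {i : ι} (hi : i ∈ I) (x : ∀ i, V i) :
    f (update x i 0) = 0 := by
  have := hf.add i hi x 0 0
  simpa using this

theorem sum {κ : Type*} (s : Finset κ) {F : κ → (∀ i, V i) → H}
    (h : ∀ k ∈ s, MultilinearOn I (F k)) : MultilinearOn I (fun x => ∑ k ∈ s, F k x) where
  congr x y hxy := sum_congr rfl fun k hk => (h k hk).congr x y hxy
  add i hi x a b := by
    rw [← sum_add_distrib]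
    exact sum_congr rfl fun k hk => (h k hk).add i hi x a b

theorem sub (hf : MultilinearOn I f) (hg : MultilinearOn I g) :
    MultilinearOn I (fun x => f x - g x) where
  congr x y hxy := by simp only [hf.congr x y hxy, hg.congr x y hxy]
  add i hi x a b := by
    simp only [hf.add i hi, hg.add i hi]
    abel

theorem comp {H' : Type} [AddCommGroup H'] (hf : MultilinearOn I f) (l : H →+ H') :
    MultilinearOn I (fun x => l (f x)) where
  congr x y hxy := by simp only [hf.congr x y hxy]
  add i hi x a b := by simp only [hf.add i hi, map_add]

/-- Fixing the coordinates outside `S`. -/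
theorem piecewise_left (hf : MultilinearOn I f) (S : Finset ι) (k : ∀ i, V i) :
    MultilinearOn (I ∩ S) (fun x => f (S.piecewise x k)) where
  congr x y hxy := hf.congr _ _ fun i hi => by
    by_cases h : i ∈ S
    · simpa [h] using hxy i (mem_inter.2 ⟨hi, h⟩)
    · simp [h]
  add i hi x a b := by
    obtain ⟨h1, h2⟩ := mem_inter.1 hi
    have key : ∀ c : V i, S.piecewise (update x i c) k = update (S.piecewise x k) i c := by
      intro c
      rw [Finset.update_piecewise_of_mem _ _ _ h2]
    simp only [key, hf.add i h1]

/-- Fixing the coordinates inside `S`. -/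
theorem piecewise_right (hf : MultilinearOn I f) (S : Finset ι) (x : ∀ i, V i) :
    MultilinearOn (I \ S) (fun k => f (S.piecewise x k)) where
  congr k l hkl := hf.congr _ _ fun i hi => by
    by_cases h : i ∈ S
    · simp [h]
    · simpa [h] using hkl i (mem_sdiff.2 ⟨hi, h⟩)
  add i hi k a b := by
    obtain ⟨h1, h2⟩ := mem_sdiff.1 hi
    have key : ∀ c : V i, S.piecewise x (update k i c) = update (S.piecewise x k) i c := by
      intro c
      rw [Finset.update_piecewise_of_notMem _ _ _ h2]
    simp only [key, hf.add i h1]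

theorem update_right (hf : MultilinearOn I f) (t : ι) (v : V t) :
    MultilinearOn (I.erase t) (fun x => f (update x t v)) where
  congr x y hxy := hf.congr _ _ fun i hi => by
    by_cases h : i = t
    · subst h; simp
    · simpa [h] using hxy i (mem_erase.2 ⟨h, hi⟩)
  add i hi x a b := by
    obtain ⟨h1, h2⟩ := mem_erase.1 hi
    simp only [update_comm h1, hf.add i h2]

theorem mul {R : Type} [CommRing R] {a b : (∀ i, V i) → R} (ha : MultilinearOn I a)
    (hb : MultilinearOn J b) (hIJ : Disjoint I J) : MultilinearOn (I ∪ J) (fun x => a x * b x) where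
  congr x y hxy := by
    simp only [ha.congr x y fun i hi => hxy i (mem_union_left _ hi),
      hb.congr x y fun i hi => hxy i (mem_union_right _ hi)]
  add i hi x c d := by
    rcases mem_union.1 hi with h | h
    · have h' : i ∉ J := fun h' => (disjoint_left.1 hIJ h h').elim
      simp only [ha.add i h, hb.update_of_notMem h', add_mul]
    · have h' : i ∉ I := fun h' => (disjoint_left.1 hIJ h' h).elim
      simp only [hb.add i h, ha.update_of_notMem h', mul_add]

/-- A form evaluated at a vertex `ω.piecewise (p + q) q` of a combinatorial cube. -/
theorem apply_vertex (hf : MultilinearOn I f) (p : ∀ i, V i) {ω : Finset ι} (hω : ω ⊆ I) :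
    ∀ q : ∀ i, V i, f (ω.piecewise (p + q) q) = ∑ S ∈ ω.powerset, f (S.piecewise p q) := by
  induction ω using Finset.induction_on with
  | empty => intro q; simp
  | insert i ω hi ih =>
    intro q
    have hω' : ω ⊆ I := (subset_insert i ω).trans hω
    have e1 : update (ω.piecewise (p + q) q) i (p i) =
        ω.piecewise (p + update q i (p i)) (update q i (p i)) := by
      funext j
      by_cases hj : j = i
      · subst hj; simp [hi]
      · by_cases hjω : j ∈ ω <;> simp [hj, hjω]
    have e2 : update (ω.piecewise (p + q) q) i (q i) = ω.piecewise (p + q) q := by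
      rw [update_eq_self_iff]; simp [hi]
    rw [piecewise_insert, Pi.add_apply, hf.add i (hω (mem_insert_self i ω)), e1, e2, ih hω', ih hω',
      sum_powerset_insert hi, add_comm]
    congr 1
    refine sum_congr rfl fun S hS => ?_
    congr 1
    funext j
    by_cases hj : j = i
    · subst hj
      have : j ∉ S := fun h => hi (mem_powerset.1 hS h)
      simp [this]
    · by_cases hjS : j ∈ S <;> simp [hj, hjS]

end MultilinearOn

section CharTwo

variable [∀ i, Module (ZMod 2) (V i)]

/-- Summing a form over all vertices of a cube based at `h` with sides `x` gives its value at `x`. -/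
theorem MultilinearOn.sum_vertices {I : Finset ι} {f : (∀ i, V i) → H} (hf : MultilinearOn I f)
    (x h : ∀ i, V i) : ∑ ω ∈ I.powerset, f (ω.piecewise (x + h) h) = f x := by
  have := hf.apply_vertex (x + h) (subset_refl I) h
  rw [add_add_cancel_two] at this
  rw [← this]
  exact hf.congr _ _ fun i hi => by simp [hi]

end CharTwo

end Multilinear

/-! ### Density -/

section Density

variable {α : Type} [Fintype α]

/-- The density of a set in a finite type. -/
noncomputable def dens (A : Set α) : ℝ := (∑ x, A.indicator 1 x) / Fintype.card α

theorem sum_indicator_eq_ncard (A : Set α) : ∑ x, A.indicator (1 : α → ℝ) x = A.ncard := by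
  classical
  simp [Set.indicator, Finset.sum_boole, Set.ncard_eq_toFinset_card']

theorem dens_eq_ncard (A : Set α) : dens A = A.ncard / Fintype.card α := by
  rw [dens, sum_indicator_eq_ncard]

theorem dens_nonneg (A : Set α) : 0 ≤ dens A := by
  rw [dens_eq_ncard]; positivity

theorem dens_mono {A B : Set α} (h : A ⊆ B) : dens A ≤ dens B := by
  rw [dens_eq_ncard, dens_eq_ncard]
  gcongr
  exact B.toFinite

theorem dens_univ [Nonempty α] : dens (Set.univ : Set α) = 1 := by
  rw [dens_eq_ncard, Set.ncard_univ, Nat.card_eq_fintype_card]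
  exact div_self (by simp)

theorem dens_le_one (A : Set α) : dens A ≤ 1 := by
  rw [dens_eq_ncard, ← Nat.card_eq_fintype_card]
  refine div_le_one_of_le₀ ?_ (by positivity)
  exact_mod_cast Set.ncard_le_card A

theorem dens_union_le (A B : Set α) : dens (A ∪ B) ≤ dens A + dens B := by
  rw [dens_eq_ncard, dens_eq_ncard, dens_eq_ncard, ← add_div]
  gcongr
  exact_mod_cast Set.ncard_union_le A B

theorem dens_biUnion_le {κ : Type*} (s : Finset κ) (A : κ → Set α) :
    dens (⋃ k ∈ s, A k) ≤ ∑ k ∈ s, dens (A k) := by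
  classical
  induction s using Finset.induction_on with
  | empty => simp [dens]
  | insert k s hk ih =>
    rw [Finset.set_biUnion_insert, sum_insert hk]
    exact (dens_union_le _ _).trans (by gcongr)

theorem dens_preimage_equiv (e : α ≃ α) (A : Set α) : dens (e ⁻¹' A) = dens A := by
  rw [dens, dens]
  congr 1
  exact Fintype.sum_equiv e _ _ fun x => rfl

theorem exists_mem_notMem_of_dens_lt {A B : Set α} (h : dens A < dens B) : ∃ x ∈ B, x ∉ A := by
  by_contra! hc
  exact absurd (dens_mono hc) (not_le.2 h)

theorem sum_dens_comm {β : Type} [Fintype β] (R : α → β → Prop) :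
    (∑ b, dens {a | R a b}) * Fintype.card α = (∑ a, dens {b | R a b}) * Fintype.card β := by
  classical
  rcases isEmpty_or_nonempty α with h | h
  · simp
  rcases isEmpty_or_nonempty β with h' | h'
  · simp
  have e1 : ∀ A : Set α, dens A * Fintype.card α = ∑ x, A.indicator 1 x := fun A =>
    div_mul_cancel₀ _ (by simp)
  have e2 : ∀ A : Set β, dens A * Fintype.card β = ∑ x, A.indicator 1 x := fun A =>
    div_mul_cancel₀ _ (by simp)
  simp only [sum_mul, e1, e2]
  rw [sum_comm]
  rfl

end Density

/-! ### Forms and their common zeros -/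

section Forms

variable {ι : Type} [DecidableEq ι] {V : ι → Type} [∀ i, AddCommGroup (V i)]

/-- The multilinear forms in a nonempty set of coordinates contained in `I`. -/
def Forms (V : ι → Type) [∀ i, AddCommGroup (V i)] (I : Finset ι) : Set ((∀ i, V i) → ZMod 2) :=
  {ψ | ∃ J : Finset ι, J.Nonempty ∧ J ⊆ I ∧ MultilinearOn J ψ}

/-- The common zeros of a finite set of functions. -/
def zeroSet (P : Finset ((∀ i, V i) → ZMod 2)) : Set (∀ i, V i) := {x | ∀ ψ ∈ P, ψ x = 0}

theorem Forms.mono {I K : Finset ι} (h : I ⊆ K) : Forms V I ⊆ Forms V K := by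
  rintro ψ ⟨J, h1, h2, h3⟩
  exact ⟨J, h1, h2.trans h, h3⟩

/-- A set whose intersection with every line parallel to a coordinate space `V t` is closed under
addition. -/
def CoordClosed (A : Set (∀ i, V i)) : Prop :=
  ∀ t x a b, update x t a ∈ A → update x t b ∈ A → update x t (a + b) ∈ A

theorem CoordClosed.inter {A B : Set (∀ i, V i)} (hA : CoordClosed A) (hB : CoordClosed B) :
    CoordClosed (A ∩ B) :=
  fun t x a b ha hb => ⟨hA t x a b ha.1 hb.1, hB t x a b ha.2 hb.2⟩

theorem coordClosed_univ : CoordClosed (Set.univ : Set (∀ i, V i)) := fun _ _ _ _ _ _ => trivial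

theorem MultilinearOn.coordClosed {H : Type} [AddCommGroup H] {I : Finset ι}
    {f : (∀ i, V i) → H} (hf : MultilinearOn I f) : CoordClosed {x | f x = 0} := by
  intro t x a b ha hb
  by_cases ht : t ∈ I
  · simp only [Set.mem_ofPred_eq] at *
    rw [hf.add t ht, ha, hb, add_zero]
  · simp only [Set.mem_ofPred_eq] at *
    rw [hf.update_of_notMem ht] at *
    exact ha

variable [∀ i, Fintype (V i)] [Fintype ι]

/-- Imposing one more form at most halves a coordinatewise closed set: in each line parallel to `V t`,
where `t` is a variable of the form, the form is additive. -/
theorem CoordClosed.dens_inter_zero {A : Set (∀ i, V i)} (hA : CoordClosed A) {I : Finset ι}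
    {ψ : (∀ i, V i) → ZMod 2} (hψ : ψ ∈ Forms V I) :
    dens A ≤ 2 * dens (A ∩ {x | ψ x = 0}) := by
  classical
  obtain ⟨J, ⟨t, ht⟩, -, hJ⟩ := hψ
  let β : (∀ i, V i) → V t := fun z =>
    if h : ∃ b, update z t b ∈ A ∧ ψ (update z t b) ≠ 0 then h.choose else 0
  let F : (∀ i, V i) → (∀ i, V i) := fun x => update x t (x t + β (update x t 0))
  have hF : ∀ x ∈ A ∩ {x | ψ x ≠ 0}, F x ∈ A ∩ {x | ψ x = 0} := by
    rintro x ⟨hxA, hx⟩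
    have h : ∃ b, update (update x t 0) t b ∈ A ∧ ψ (update (update x t 0) t b) ≠ 0 :=
      ⟨x t, by simpa using hxA, by simpa using hx⟩
    have hβ : β (update x t 0) = h.choose := dif_pos h
    have hs := h.choose_spec
    rw [← hβ] at hs
    simp only [update_idem] at hs
    refine ⟨hA t x _ _ (by simpa using hxA) hs.1, ?_⟩
    have one : ∀ c : ZMod 2, c ≠ 0 → c = 1 := by decide
    change ψ (update x t _) = 0
    rw [hJ.add t ht, one _ hs.2, update_eq_self, one _ hx]
    rfl
  have hinj : Set.InjOn F (A ∩ {x | ψ x ≠ 0}) := by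
    intro x _ y _ hxy
    have h0 : update x t 0 = update y t 0 := by
      have := congrArg (fun z => update z t (0 : V t)) hxy
      simpa [F] using this
    have ht' : x t = y t := by
      have := congrFun hxy t
      simpa [F, h0] using this
    have := congrArg (fun z => update z t (x t)) h0
    simp only [update_idem, update_eq_self] at this
    rw [this, ht', update_eq_self]
  have hle : (A ∩ {x | ψ x ≠ 0}).ncard ≤ (A ∩ {x | ψ x = 0}).ncard :=
    Set.ncard_le_ncard_of_injOn F hF hinj (Set.toFinite _)
  have hle' : dens (A ∩ {x | ψ x ≠ 0}) ≤ dens (A ∩ {x | ψ x = 0}) := by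
    rw [dens_eq_ncard, dens_eq_ncard]
    gcongr
  have hU : A = (A ∩ {x | ψ x ≠ 0}) ∪ (A ∩ {x | ψ x = 0}) := by
    ext x
    by_cases h : ψ x = 0 <;> simp [h]
  calc dens A ≤ dens (A ∩ {x | ψ x ≠ 0}) + dens (A ∩ {x | ψ x = 0}) := by
        conv_lhs => rw [hU]
        exact dens_union_le _ _
    _ ≤ _ := by linarith

theorem CoordClosed.dens_inter_zeroSet {A : Set (∀ i, V i)} (hA : CoordClosed A) {I : Finset ι}
    (P : Finset ((∀ i, V i) → ZMod 2)) (hP : ∀ ψ ∈ P, ψ ∈ Forms V I) :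
    dens A ≤ 2 ^ #P * dens (A ∩ zeroSet P) := by
  classical
  induction P using Finset.induction_on generalizing A with
  | empty => simp [zeroSet]
  | insert ψ P hψP ih =>
    have hψ := hP ψ (mem_insert_self ψ P)
    have h1 := hA.dens_inter_zero hψ
    obtain ⟨J, -, -, hJ⟩ := id hψ
    have h2 := ih (hA.inter hJ.coordClosed) fun χ hχ => hP χ (mem_insert_of_mem hχ)
    have h3 : A ∩ {x | ψ x = 0} ∩ zeroSet P = A ∩ zeroSet (insert ψ P) := by
      ext x
      simp [zeroSet, and_assoc]
    rw [h3] at h2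
    rw [card_insert_of_notMem hψP, pow_succ]
    linarith

theorem one_le_two_pow_mul_dens_zeroSet {I : Finset ι}
    (P : Finset ((∀ i, V i) → ZMod 2)) (hP : ∀ ψ ∈ P, ψ ∈ Forms V I) :
    1 ≤ 2 ^ #P * dens (zeroSet P) := by
  have := coordClosed_univ.dens_inter_zeroSet P hP
  have : Nonempty (∀ i, V i) := ⟨0⟩
  rwa [dens_univ, Set.univ_inter] at *

end Forms

/-! ### Section forms and sampling -/

section SectionForms

variable {ι : Type} [DecidableEq ι] {V : ι → Type} [∀ i, AddCommGroup (V i)]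

open Classical in
/-- The forms obtained from those in `Q` by fixing at `x₀` all coordinates outside some `S ⊆ K`. -/
noncomputable def sectionForms (Q : Finset ((∀ i, V i) → ZMod 2)) (x₀ : ∀ i, V i) (K : Finset ι) :
    Finset ((∀ i, V i) → ZMod 2) :=
  ((Q ×ˢ K.powerset).image fun p x => p.1 (p.2.piecewise x x₀)).filter (· ∈ Forms V K)

variable {Q : Finset ((∀ i, V i) → ZMod 2)} {x₀ : ∀ i, V i} {K : Finset ι}

theorem card_sectionForms_le : #(sectionForms Q x₀ K) ≤ #Q * 2 ^ #K := by
  classical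
  refine (card_filter_le _ _).trans (card_image_le.trans ?_)
  rw [card_product, card_powerset]

theorem mem_forms_of_mem_sectionForms {ψ : (∀ i, V i) → ZMod 2} (h : ψ ∈ sectionForms Q x₀ K) :
    ψ ∈ Forms V K := by
  classical
  exact (mem_filter.1 h).2

theorem apply_eq_zero_of_mem_zeroSet_sectionForms {x : ∀ i, V i}
    (hx : x ∈ zeroSet (sectionForms Q x₀ K)) {q : (∀ i, V i) → ZMod 2} (hq : q ∈ Q)
    {J : Finset ι} (hJ : MultilinearOn J q) {S : Finset ι} (hS : S ⊆ K) (hne : (J ∩ S).Nonempty) :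
    q (S.piecewise x x₀) = 0 := by
  classical
  refine hx (fun x => q (S.piecewise x x₀)) (mem_filter.2 ⟨mem_image.2 ⟨(q, S), ?_, rfl⟩, ?_⟩)
  · exact mem_product.2 ⟨hq, mem_powerset.2 hS⟩
  · exact ⟨J ∩ S, hne, inter_subset_right.trans hS, hJ.piecewise_left S x₀⟩

/-- For a common zero `x`, the section forms at `x` cut out base points `h` such that the cube with
sides `x` based at `h` consists of common zeros. -/
theorem vertex_mem_zeroSet {x h : ∀ i, V i} (hQ : ∀ q ∈ Q, q ∈ Forms V K) (hx : x ∈ zeroSet Q)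
    (hh : h ∈ zeroSet (sectionForms Q x K)) (ω : Finset ι) :
    ω.piecewise (x + h) h ∈ zeroSet Q := by
  intro q hq
  obtain ⟨J, -, hJK, hJ⟩ := hQ q hq
  have e : q (ω.piecewise (x + h) h) = q ((ω ∩ J).piecewise (x + h) h) :=
    hJ.congr _ _ fun i hi => by by_cases hω : i ∈ ω <;> simp [hi, hω]
  rw [e, hJ.apply_vertex x inter_subset_right]
  refine sum_eq_zero fun U _ => ?_
  have e' : q (U.piecewise x h) = q ((J \ U).piecewise h x) :=
    hJ.congr _ _ fun i hi => by by_cases hU : i ∈ U <;> simp [hi, hU]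
  rw [e']
  by_cases hne : (J \ U).Nonempty
  · refine apply_eq_zero_of_mem_zeroSet_sectionForms hh hq hJ (sdiff_subset.trans hJK) ?_
    rwa [inter_eq_right.2 sdiff_subset]
  · rw [not_nonempty_iff_eq_empty.1 hne, piecewise_empty]
    exact hx q hq

end SectionForms

section Sampling

variable {α : Type} [Fintype α] {H : Type} [AddCommGroup H] [Module (ZMod 2) H] [Finite H]

theorem card_dual_le_two_mul [Fintype (Module.Dual (ZMod 2) H)] [DecidableEq (ZMod 2)] {w : H}
    (hw : w ≠ 0) :
    2 * #{l : Module.Dual (ZMod 2) H | l w = 0} ≤ Fintype.card (Module.Dual (ZMod 2) H) := by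
  classical
  obtain ⟨l₀, hl₀⟩ : ∃ l₀ : Module.Dual (ZMod 2) H, l₀ w ≠ 0 := by
    by_contra! hc
    exact hw ((Module.forall_dual_apply_eq_zero_iff (ZMod 2) w).1 hc)
  have h1 : #{l : Module.Dual (ZMod 2) H | l w = 0} ≤ #{l : Module.Dual (ZMod 2) H | ¬ l w = 0} := by
    refine card_le_card_of_injOn (· + l₀) ?_ (fun a _ b _ h => add_right_cancel h)
    intro l hl
    have hl' : l w = 0 := by simpa using hl
    simpa [hl'] using hl₀
  have h2 := card_filter_add_card_filter_not (s := (univ : Finset (Module.Dual (ZMod 2) H)))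
    (fun l => l w = 0)
  rw [card_univ] at h2
  omega

/-- The zero set of `Φ` is approximated from outside by that of few functionals of `Φ`: a random
functional kills only half of the points at which `Φ` does not vanish. -/
theorem exists_functionals (Φ : α → H) (s : ℕ) :
    ∃ Λ : Finset (Module.Dual (ZMod 2) H), #Λ ≤ s ∧
      2 ^ s * dens {x | Φ x ≠ 0 ∧ ∀ l ∈ Λ, l (Φ x) = 0} ≤ 1 := by
  classical
  have : Finite (Module.Dual (ZMod 2) H) := Finite.of_injective _ DFunLike.coe_injective
  have := Fintype.ofFinite (Module.Dual (ZMod 2) H)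
  induction s with
  | zero => exact ⟨∅, by simp, by simpa using dens_le_one _⟩
  | succ s ih =>
    obtain ⟨Λ, hΛ, hs⟩ := ih
    set B : Set α := {x | Φ x ≠ 0 ∧ ∀ l ∈ Λ, l (Φ x) = 0} with hB
    have hN : (0 : ℝ) < Fintype.card (Module.Dual (ZMod 2) H) := by
      exact_mod_cast Fintype.card_pos
    have hcomm := sum_dens_comm (fun (x : α) (l : Module.Dual (ZMod 2) H) => x ∈ B ∧ l (Φ x) = 0)
    have hhalf : ∀ x, dens {l : Module.Dual (ZMod 2) H | x ∈ B ∧ l (Φ x) = 0} ≤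
        B.indicator 1 x * (1 / 2) := by
      intro x
      by_cases hx : x ∈ B
      · rw [dens_eq_ncard, div_le_iff₀ hN, Set.indicator_of_mem hx]
        have h := card_dual_le_two_mul (w := Φ x) hx.1
        have h' : {l : Module.Dual (ZMod 2) H | x ∈ B ∧ l (Φ x) = 0}.ncard =
            #{l : Module.Dual (ZMod 2) H | l (Φ x) = 0} := by
          rw [Set.ncard_eq_toFinset_card']
          congr 1
          ext l
          simp [hx]
        rw [h', Pi.one_apply]
        have : (2 : ℝ) * (#{l : Module.Dual (ZMod 2) H | l (Φ x) = 0} : ℝ) ≤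
          Fintype.card (Module.Dual (ZMod 2) H) := by exact_mod_cast h
        linarith
      · simp [hx, dens]
    obtain ⟨l, hl⟩ : ∃ l : Module.Dual (ZMod 2) H,
        dens {x | x ∈ B ∧ l (Φ x) = 0} ≤ dens B / 2 := by
      rcases isEmpty_or_nonempty α with hα | hα
      · exact ⟨0, by simp [dens]⟩
      have hα' : (0 : ℝ) < Fintype.card α := by exact_mod_cast Fintype.card_pos
      by_contra! hc
      have h1 : ∑ _l : Module.Dual (ZMod 2) H, dens B / 2 <
          ∑ l : Module.Dual (ZMod 2) H, dens {x | x ∈ B ∧ l (Φ x) = 0} :=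
        sum_lt_sum_of_nonempty univ_nonempty fun l _ => hc l
      have h2 := sum_le_sum fun x (_ : x ∈ (univ : Finset α)) => hhalf x
      rw [← sum_mul] at h2
      rw [sum_const, card_univ, nsmul_eq_mul] at h1
      have h3 : dens B * Fintype.card α = ∑ x, B.indicator 1 x := div_mul_cancel₀ _ hα'.ne'
      rw [← h3] at h2
      have h4 := mul_lt_mul_of_pos_right h1 hα'
      rw [hcomm] at h4
      have h5 := mul_le_mul_of_nonneg_right h2 hN.le
      linarith
    refine ⟨insert l Λ, (card_insert_le _ _).trans (by omega), ?_⟩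
    have e : {x | Φ x ≠ 0 ∧ ∀ m ∈ insert l Λ, m (Φ x) = 0} = {x | x ∈ B ∧ l (Φ x) = 0} := by
      ext x
      simp only [hB, Finset.forall_mem_insert, Set.mem_ofPred_eq]
      tauto
    rw [e, pow_succ]
    have : (0 : ℝ) ≤ 2 ^ s := by positivity
    nlinarith [mul_le_mul_of_nonneg_left hl this]

end Sampling

/-! ### Dense zero sets contain varieties of bounded codimension -/

section DenseVariety

variable {ι : Type} [Fintype ι] [DecidableEq ι] {V : ι → Type} [∀ i, Fintype (V i)]

/-- If `x` and `k` are uniform and independent, then so is `S.piecewise x k`. -/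
theorem sum_dens_piecewise (S : Finset ι) (A : Set (∀ i, V i)) :
    ∑ k, dens {x | S.piecewise x k ∈ A} = Fintype.card (∀ i, V i) * dens A := by
  rcases isEmpty_or_nonempty (∀ i, V i) with h | h
  · simp
  let e : ((∀ i, V i) × (∀ i, V i)) ≃ ((∀ i, V i) × (∀ i, V i)) :=
    { toFun := fun p => (S.piecewise p.1 p.2, S.piecewise p.2 p.1)
      invFun := fun p => (S.piecewise p.1 p.2, S.piecewise p.2 p.1)
      left_inv := fun p => by
        ext i <;> by_cases hi : i ∈ S <;> simp [hi]
      right_inv := fun p => by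
        ext i <;> by_cases hi : i ∈ S <;> simp [hi] }
  have hN : (Fintype.card (∀ i, V i) : ℝ) ≠ 0 := Nat.cast_ne_zero.2 Fintype.card_ne_zero
  have h1 : ∑ p : (∀ i, V i) × (∀ i, V i), A.indicator (1 : (∀ i, V i) → ℝ) (S.piecewise p.1 p.2) =
      ∑ p : (∀ i, V i) × (∀ i, V i), A.indicator (1 : (∀ i, V i) → ℝ) p.1 :=
    Fintype.sum_equiv e _ _ fun p => rfl
  rw [Fintype.sum_prod_type_right, Fintype.sum_prod_type] at h1
  simp only [sum_const, card_univ, nsmul_eq_mul, ← mul_sum] at h1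
  have h2 : (∑ k, dens {x | S.piecewise x k ∈ A}) =
      (∑ k, ∑ x, A.indicator (1 : (∀ i, V i) → ℝ) (S.piecewise x k)) /
        Fintype.card (∀ i, V i) := by
    rw [sum_div]
    rfl
  rw [h2, h1, dens, mul_div_assoc]

variable [∀ i, AddCommGroup (V i)]

theorem dens_vertex_mem (ω : Finset ι) (x : ∀ i, V i) (A : Set (∀ i, V i)) :
    dens {h | ω.piecewise (x + h) h ∈ A} = dens A := by
  rw [← dens_preimage_equiv (Equiv.addRight (ω.piecewise x 0)) A]
  congr 1
  ext h
  have : ω.piecewise (x + h) h = h + ω.piecewise x 0 := by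
    funext i
    by_cases hi : i ∈ ω <;> simp [hi, add_comm]
  simp [this]

/-- Some fibre of a dense set is dense and consists, up to a set of density proportional to `c`, of
points whose opposite fibre has density at least `c`. -/
theorem exists_fibre (S : Finset ι) (Z : Set (∀ i, V i)) {η c : ℝ} (hη : 0 < η) (hc : 0 < c)
    (hZ : η ≤ dens Z) :
    ∃ k, η / 2 ≤ dens {x | S.piecewise x k ∈ Z} ∧
      dens {x | S.piecewise x k ∈ Z ∧ dens {l | S.piecewise x l ∈ Z} < c} ≤ 2 * c / η := by
  have : Nonempty (∀ i, V i) := ⟨0⟩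
  have hN : (0 : ℝ) < Fintype.card (∀ i, V i) := by exact_mod_cast Fintype.card_pos
  set B : (∀ i, V i) → Set (∀ i, V i) := fun k =>
    {x | S.piecewise x k ∈ Z ∧ dens {l | S.piecewise x l ∈ Z} < c} with hB
  have h1 := sum_dens_piecewise S Z
  have h2 : ∑ k, dens (B k) ≤ Fintype.card (∀ i, V i) * c := by
    have h := sum_dens_comm
      fun x k => S.piecewise x k ∈ Z ∧ dens {l | S.piecewise x l ∈ Z} < c
    rw [mul_right_cancel₀ hN.ne' h]
    calc _ ≤ ∑ _x : (∀ i, V i), c := by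
          refine sum_le_sum fun x _ => ?_
          by_cases hx : dens {l | S.piecewise x l ∈ Z} < c
          · exact (dens_mono fun k hk => hk.1).trans hx.le
          · simp only [hx, and_false]
            exact le_of_eq_of_le (by simp [dens]) hc.le
      _ = _ := by simp
  obtain ⟨k, -, hk⟩ : ∃ k ∈ (univ : Finset (∀ i, V i)),
      η / 2 ≤ dens {x | S.piecewise x k ∈ Z} - η / (2 * c) * dens (B k) := by
    refine exists_le_of_sum_le univ_nonempty ?_
    rw [sum_sub_distrib, ← mul_sum, h1, sum_const, card_univ, nsmul_eq_mul]
    have h3 : η / (2 * c) * ∑ k, dens (B k) ≤ η / (2 * c) * (Fintype.card (∀ i, V i) * c) := by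
      gcongr
    have h4 : η / (2 * c) * (Fintype.card (∀ i, V i) * c) = Fintype.card (∀ i, V i) * (η / 2) := by
      field_simp
    have h5 := mul_le_mul_of_nonneg_left hZ hN.le
    linarith
  have hpos : 0 ≤ η / (2 * c) * dens (B k) := mul_nonneg (by positivity) (dens_nonneg _)
  refine ⟨k, by linarith, ?_⟩
  have h6 : η / (2 * c) * dens (B k) ≤ 1 := by
    have := dens_le_one {x | S.piecewise x k ∈ Z}
    linarith
  rw [le_div_iff₀ hη]
  rw [div_mul_eq_mul_div, div_le_one (by positivity)] at h6
  linarith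

end DenseVariety

/-- For each `η > 0`, every multilinear map in at most `d` variables whose zero set has density at
least `η` vanishes on the common zeros of boundedly many forms. -/
def DenseZeroBound (d : ℕ) : Prop :=
  ∀ η : ℝ, 0 < η → ∃ M : ℕ, ∀ (ι : Type) [Fintype ι] [DecidableEq ι] (V : ι → Type)
    [∀ i, AddCommGroup (V i)] [∀ i, Module (ZMod 2) (V i)] [∀ i, Fintype (V i)]
    (H : Type) [AddCommGroup H] [Module (ZMod 2) H] [Finite H]
    (I : Finset ι) (Φ : (∀ i, V i) → H), #I ≤ d → MultilinearOn I Φ → η ≤ dens {x | Φ x = 0} →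
    ∃ P : Finset ((∀ i, V i) → ZMod 2), #P ≤ M ∧ (∀ ψ ∈ P, ψ ∈ Forms V I) ∧
      zeroSet P ⊆ {x | Φ x = 0}

/-- Many sections of a multilinear map with dense zero set have themselves large zero sets: for `x`
in a variety of bounded codimension, the section at `x_S` vanishes on a variety of bounded
codimension. -/
theorem DenseZeroBound.sections {d : ℕ} (hd : DenseZeroBound d) (η : ℝ) (hη : 0 < η) :
    ∃ M M' : ℕ, ∀ (ι : Type) [Fintype ι] [DecidableEq ι] (V : ι → Type)
    [∀ i, AddCommGroup (V i)] [∀ i, Module (ZMod 2) (V i)] [∀ i, Fintype (V i)]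
    (H : Type) [AddCommGroup H] [Module (ZMod 2) H] [Finite H]
    (I : Finset ι) (Φ : (∀ i, V i) → H), #I ≤ d + 1 → MultilinearOn I Φ → η ≤ dens {x | Φ x = 0} →
    ∀ S : Finset ι, S.Nonempty → S ⊂ I →
    ∃ W : Finset ((∀ i, V i) → ZMod 2), #W ≤ M ∧ (∀ ψ ∈ W, ψ ∈ Forms V S) ∧
      ∀ x ∈ zeroSet W, ∃ θ : Finset ((∀ i, V i) → ZMod 2), #θ ≤ M' ∧
        (∀ ψ ∈ θ, ψ ∈ Forms V (I \ S)) ∧ zeroSet θ ⊆ {k | Φ (S.piecewise x k) = 0} := by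
  classical
  obtain ⟨M, hM⟩ := hd (η / 2) (by positivity)
  -- Small against the density `2 ^ (-M 2 ^ d)` of the cubes inside a variety cut out by `M` forms.
  set c : ℝ := η / (4 * 2 ^ d * 2 ^ (M * 2 ^ d)) with hc
  have hc0 : 0 < c := by positivity
  obtain ⟨M₁, hM₁⟩ := hd c hc0
  refine ⟨M, 2 ^ d * M₁, ?_⟩
  intro ι _ _ V _ _ _ H _ _ _ I Φ hI hΦ hdens S hSne hSI
  have hSd : #S ≤ d := by
    have := card_lt_card hSI
    omega
  have hISd : #(I \ S) ≤ d := by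
    have := card_sdiff_add_card_eq_card hSI.1
    have := hSne.card_pos
    omega
  obtain ⟨k, hk1, hk2⟩ := exists_fibre S {x | Φ x = 0} hη hc0 hdens
  have hΦS : ∀ k, MultilinearOn S (fun x => Φ (S.piecewise x k)) := fun k => by
    have := hΦ.piecewise_left S k
    rwa [inter_eq_right.2 hSI.1] at this
  obtain ⟨W, hWM, hWf, hWz⟩ := hM ι V H S _ hSd (hΦS k) hk1
  refine ⟨W, hWM, hWf, fun x hx => ?_⟩
  set B : Set (∀ i, V i) := {x | S.piecewise x k ∈ {x | Φ x = 0} ∧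
    dens {l | S.piecewise x l ∈ {x | Φ x = 0}} < c} with hB
  obtain ⟨h, hhE, hhB⟩ : ∃ h ∈ zeroSet (sectionForms W x S),
      h ∉ ⋃ ω ∈ S.powerset, {h | ω.piecewise (x + h) h ∈ B} := by
    apply exists_mem_notMem_of_dens_lt
    have h1 := one_le_two_pow_mul_dens_zeroSet (sectionForms W x S)
      fun ψ => mem_forms_of_mem_sectionForms
    have hE : #(sectionForms W x S) ≤ M * 2 ^ d := card_sectionForms_le.trans (by gcongr; norm_num)
    have h2 : (1 : ℝ) ≤ 2 ^ (M * 2 ^ d) * dens (zeroSet (sectionForms W x S)) := by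
      refine h1.trans (mul_le_mul_of_nonneg_right ?_ (dens_nonneg _))
      exact pow_le_pow_right₀ (by norm_num) hE
    have h3 : dens (⋃ ω ∈ S.powerset, {h | ω.piecewise (x + h) h ∈ B}) ≤ 2 ^ d * (2 * c / η) := by
      refine (dens_biUnion_le _ _).trans ?_
      simp only [dens_vertex_mem, sum_const, card_powerset, nsmul_eq_mul]
      refine mul_le_mul ?_ hk2 (dens_nonneg _) (by positivity)
      push_cast
      exact pow_le_pow_right₀ (by norm_num) hSd
    have h4 : (2 : ℝ) ^ d * (2 * c / η) * 2 ^ (M * 2 ^ d) = 1 / 2 := by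
      rw [hc]
      field_simp
      norm_num
    have h5 : (0 : ℝ) < 2 ^ (M * 2 ^ d) := by positivity
    refine h3.trans_lt ?_
    by_contra! h6
    have := mul_le_mul_of_nonneg_left h6 h5.le
    linarith
  have hgood : ∀ ω ∈ S.powerset,
      c ≤ dens {l | Φ (S.piecewise (ω.piecewise (x + h) h) l) = 0} := by
    intro ω hω
    by_contra! hlt
    refine hhB (Set.mem_biUnion hω ⟨?_, hlt⟩)
    exact hWz (vertex_mem_zeroSet hWf hx hhE ω)
  have hθ : ∀ ω, ∃ θ : Finset ((∀ i, V i) → ZMod 2), ω ∈ S.powerset → #θ ≤ M₁ ∧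
      (∀ ψ ∈ θ, ψ ∈ Forms V (I \ S)) ∧
        zeroSet θ ⊆ {l | Φ (S.piecewise (ω.piecewise (x + h) h) l) = 0} := by
    intro ω
    by_cases hω : ω ∈ S.powerset
    · obtain ⟨θ, hθ⟩ := hM₁ ι V H (I \ S) _ hISd
        (hΦ.piecewise_right S (ω.piecewise (x + h) h)) (hgood ω hω)
      exact ⟨θ, fun _ => hθ⟩
    · exact ⟨∅, fun h => absurd h hω⟩
  choose θ hθ using hθ
  refine ⟨S.powerset.biUnion θ, ?_, ?_, ?_⟩
  · refine (card_biUnion_le_card_mul _ _ M₁ fun ω hω => (hθ ω hω).1).trans ?_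
    rw [card_powerset]
    gcongr
    norm_num
  · intro ψ hψ
    obtain ⟨ω, hω, hψω⟩ := mem_biUnion.1 hψ
    exact (hθ ω hω).2.1 ψ hψω
  · intro l hl
    change Φ (S.piecewise x l) = 0
    rw [← (hΦS l).sum_vertices x h]
    refine sum_eq_zero fun ω hω => (hθ ω hω).2.2 fun ψ hψ => hl ψ (mem_biUnion.2 ⟨ω, hω, hψ⟩)

theorem DenseZeroBound.succ {d : ℕ} (hd : DenseZeroBound d) : DenseZeroBound (d + 1) := by
  classical
  intro η hη
  obtain ⟨M, M', hM⟩ := hd.sections η hη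
  set N : ℕ := 2 ^ (d + 1) * M' with hN
  obtain ⟨s, hs⟩ : ∃ s : ℕ, 2 ^ N / η < 2 ^ s := by
    obtain ⟨s, hs⟩ := pow_unbounded_of_one_lt (2 ^ N / η) (one_lt_two : (1 : ℝ) < 2)
    exact ⟨s, hs⟩
  refine ⟨2 ^ (d + 1) * M + s, ?_⟩
  intro ι _ _ V _ _ _ H _ _ _ I Φ hI hΦ hdens
  rcases I.eq_empty_or_nonempty with rfl | hIne
  · refine ⟨∅, by simp, by simp, fun x _ => ?_⟩
    obtain ⟨y, hy, -⟩ := exists_mem_notMem_of_dens_lt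
      (A := (∅ : Set (∀ i, V i))) (B := {x | Φ x = 0}) (by
        have : dens (∅ : Set (∀ i, V i)) = 0 := by simp [dens]
        linarith)
    exact (hΦ.congr x y (by simp)).trans hy
  obtain ⟨Λ, hΛs, hΛ⟩ := exists_functionals Φ s
  have hW : ∀ S : Finset ι, ∃ W : Finset ((∀ i, V i) → ZMod 2), #W ≤ M ∧ (∀ ψ ∈ W, ψ ∈ Forms V I) ∧
      (S.Nonempty → S ⊂ I → ∀ x ∈ zeroSet W, ∃ θ : Finset ((∀ i, V i) → ZMod 2), #θ ≤ M' ∧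
        (∀ ψ ∈ θ, ψ ∈ Forms V I) ∧ zeroSet θ ⊆ {k | Φ (S.piecewise x k) = 0}) := by
    intro S
    by_cases hS : S.Nonempty ∧ S ⊂ I
    · obtain ⟨W, h1, h2, h3⟩ := hM ι V H I Φ hI hΦ hdens S hS.1 hS.2
      refine ⟨W, h1, fun ψ hψ => Forms.mono hS.2.1 (h2 ψ hψ), fun _ _ x hx => ?_⟩
      obtain ⟨θ, h4, h5, h6⟩ := h3 x hx
      exact ⟨θ, h4, fun ψ hψ => Forms.mono sdiff_subset (h5 ψ hψ), h6⟩
    · exact ⟨∅, by simp, by simp, fun h1 h2 => absurd ⟨h1, h2⟩ hS⟩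
  choose W hWM hWf hWz using hW
  refine ⟨I.powerset.biUnion W ∪ Λ.image fun l x => l (Φ x), ?_, ?_, ?_⟩
  · refine (card_union_le _ _).trans (add_le_add ?_ (card_image_le.trans hΛs))
    refine (card_biUnion_le_card_mul _ _ M fun S _ => hWM S).trans ?_
    rw [card_powerset]
    gcongr
    norm_num
  · intro ψ hψ
    rcases mem_union.1 hψ with hψ | hψ
    · obtain ⟨S, -, hψS⟩ := mem_biUnion.1 hψ
      exact hWf S ψ hψS
    · obtain ⟨l, -, rfl⟩ := mem_image.1 hψ
      exact ⟨I, hIne, subset_rfl, hΦ.comp l.toAddMonoidHom⟩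
  intro x hx
  have hxW : ∀ S ∈ I.powerset, x ∈ zeroSet (W S) := fun S hS ψ hψ =>
    hx ψ (mem_union_left _ (mem_biUnion.2 ⟨S, hS, hψ⟩))
  have hxΛ : ∀ l ∈ Λ, l (Φ x) = 0 := fun l hl =>
    hx _ (mem_union_right _ (mem_image.2 ⟨l, hl, rfl⟩))
  have hθ : ∀ S : Finset ι, ∃ θ : Finset ((∀ i, V i) → ZMod 2), #θ ≤ M' ∧
      (∀ ψ ∈ θ, ψ ∈ Forms V I) ∧
      (S.Nonempty → S ⊂ I → zeroSet θ ⊆ {k | Φ (S.piecewise x k) = 0}) := by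
    intro S
    by_cases hS : S.Nonempty ∧ S ⊂ I
    · obtain ⟨θ, h1, h2, h3⟩ := hWz S hS.1 hS.2 x (hxW S (mem_powerset.2 hS.2.1))
      exact ⟨θ, h1, h2, fun _ _ => h3⟩
    · exact ⟨∅, by simp, by simp, fun h1 h2 => absurd ⟨h1, h2⟩ hS⟩
  choose θ hθM hθf hθz using hθ
  set Θ := I.powerset.biUnion θ with hΘ
  have hΘN : #Θ ≤ N := by
    refine (card_biUnion_le_card_mul _ _ M' fun S _ => hθM S).trans ?_
    rw [card_powerset, hN]
    gcongr
    norm_num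
  have hΘf : ∀ ψ ∈ Θ, ψ ∈ Forms V I := by
    intro ψ hψ
    obtain ⟨S, -, hψS⟩ := mem_biUnion.1 hψ
    exact hθf S ψ hψS
  -- For such `h`, `Φ` vanishes at all mixtures of `x` and `h` other than `x`, so `Φ (x + h) = Φ x`.
  obtain ⟨h, ⟨hhZ, hhΘ⟩, hhb⟩ : ∃ h ∈ {x | Φ x = 0} ∩ zeroSet Θ,
      h ∉ {h | I.piecewise (x + h) h ∈ {y | Φ y ≠ 0 ∧ ∀ l ∈ Λ, l (Φ y) = 0}} := by
    apply exists_mem_notMem_of_dens_lt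
    rw [dens_vertex_mem]
    have h1 := hΦ.coordClosed.dens_inter_zeroSet Θ hΘf
    have h2 : (2 : ℝ) ^ #Θ ≤ 2 ^ N := pow_le_pow_right₀ (by norm_num) hΘN
    have h3 := mul_le_mul_of_nonneg_right h2 (dens_nonneg ({x | Φ x = 0} ∩ zeroSet Θ))
    rw [div_lt_iff₀ hη] at hs
    by_contra! hle
    have h4 : (0 : ℝ) < 2 ^ N := by positivity
    have h5 : (0 : ℝ) < 2 ^ s := by positivity
    have h6 := mul_le_mul_of_nonneg_left hle h4.le
    have h7 : η ≤ 2 ^ N * dens {y | Φ y ≠ 0 ∧ ∀ l ∈ Λ, l (Φ y) = 0} := by linarith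
    have h8 := mul_le_mul_of_nonneg_left h7 h5.le
    have h9 := mul_le_mul_of_nonneg_left hΛ h4.le
    linarith
  have hval : Φ (I.piecewise (x + h) h) = Φ x := by
    rw [hΦ.apply_vertex x subset_rfl, sum_eq_single I]
    · exact hΦ.congr _ _ fun i hi => by simp [hi]
    · intro S hS hSI
      have hS' := mem_powerset.1 hS
      rcases S.eq_empty_or_nonempty with rfl | hSne
      · simpa using hhZ
      · exact hθz S hSne (hS'.ssubset_of_ne hSI) fun ψ hψ =>
          hhΘ ψ (mem_biUnion.2 ⟨S, hS, hψ⟩)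
    · simp
  by_contra hne
  refine hhb ⟨?_, ?_⟩
  · rw [hval]
    exact hne
  · intro l hl
    rw [hval]
    exact hxΛ l hl

theorem denseZeroBound (d : ℕ) : DenseZeroBound d := by
  induction d with
  | succ d ih => exact ih.succ
  | zero =>
    intro η hη
    refine ⟨0, ?_⟩
    intro ι _ _ V _ _ _ H _ _ _ I Φ hI hΦ hdens
    obtain rfl : I = ∅ := by simpa using hI
    refine ⟨∅, by simp, by simp, fun x _ => ?_⟩
    obtain ⟨y, hy, -⟩ := exists_mem_notMem_of_dens_lt
      (A := (∅ : Set (∀ i, V i))) (B := {x | Φ x = 0}) (by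
        have : dens (∅ : Set (∀ i, V i)) = 0 := by simp [dens]
        linarith)
    exact (hΦ.congr x y (by simp)).trans hy

/-! ### Forms vanishing on a variety -/

section Vanishing

variable {ι : Type} [DecidableEq ι] {V : ι → Type} [∀ i, AddCommGroup (V i)]

/-- The span of the products `a * b` of a form `a ∈ A` in the variables `J` and a form `b` in the
variables `I \ J`, for nonempty `J ⊆ I`. -/
def productSpan (A : Finset ((∀ i, V i) → ZMod 2)) (I : Finset ι) :
    Submodule (ZMod 2) ((∀ i, V i) → ZMod 2) :=
  Submodule.span (ZMod 2) {f | ∃ a ∈ A, ∃ (J : Finset ι) (b : (∀ i, V i) → ZMod 2), J.Nonempty ∧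
    J ⊆ I ∧ MultilinearOn J a ∧ MultilinearOn (I \ J) b ∧ f = fun x => a x * b x}

theorem productSpan_mono {A B : Finset ((∀ i, V i) → ZMod 2)} (h : A ⊆ B) (I : Finset ι) :
    productSpan A I ≤ productSpan B I := by
  refine Submodule.span_mono ?_
  rintro f ⟨a, ha, rest⟩
  exact ⟨a, h ha, rest⟩

theorem apply_eq_zero_of_mem_productSpan {A : Finset ((∀ i, V i) → ZMod 2)} {I : Finset ι}
    {f : (∀ i, V i) → ZMod 2} (hf : f ∈ productSpan A I) {x : ∀ i, V i} (hx : x ∈ zeroSet A) :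
    f x = 0 := by
  induction hf using Submodule.span_induction with
  | mem f hf =>
    obtain ⟨a, ha, J, b, -, -, -, -, rfl⟩ := hf
    simp [hx a ha]
  | zero => rfl
  | add f g _ _ hf hg => simp [hf, hg]
  | smul c f _ hf => simp [hf]

theorem zero_mem_zeroSet {I : Finset ι} {P : Finset ((∀ i, V i) → ZMod 2)}
    (hP : ∀ ψ ∈ P, ψ ∈ Forms V I) : (0 : ∀ i, V i) ∈ zeroSet P := by
  intro ψ hψ
  obtain ⟨J, ⟨i, hi⟩, -, hJ⟩ := hP ψ hψ
  have := hJ.update_zero hi 0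
  rwa [show update (0 : ∀ i, V i) i 0 = 0 from update_eq_self i 0] at this

theorem update_mem_zeroSet {I : Finset ι} {P : Finset ((∀ i, V i) → ZMod 2)} {t : ι}
    (hP : ∀ ψ ∈ P, ψ ∈ Forms V (I.erase t)) {x : ∀ i, V i} (hx : x ∈ zeroSet P) (y : V t) :
    update x t y ∈ zeroSet P := by
  intro ψ hψ
  obtain ⟨J, -, hJI, hJ⟩ := hP ψ hψ
  rw [hJ.update_of_notMem (fun ht => (mem_erase.1 (hJI ht)).1 rfl)]
  exact hx ψ hψ

/-- At the vertices of a cube based at `x₀` whose sides are a common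
zero of the section forms at `x₀`, every `q ∈ Q` has the same value as at `x₀`. -/
theorem apply_vertex_eq {Q : Finset ((∀ i, V i) → ZMod 2)} {x₀ x : ∀ i, V i} {K : Finset ι}
    (hx : x ∈ zeroSet (sectionForms Q x₀ K)) {q : (∀ i, V i) → ZMod 2} (hq : q ∈ Q)
    {J : Finset ι} (hJ : MultilinearOn J q) {ω : Finset ι} (hω : ω ⊆ K) :
    q (ω.piecewise (x + x₀) x₀) = q x₀ := by
  have e : q (ω.piecewise (x + x₀) x₀) = q ((ω ∩ J).piecewise (x + x₀) x₀) :=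
    hJ.congr _ _ fun i hi => by by_cases h : i ∈ ω <;> simp [hi, h]
  rw [e, hJ.apply_vertex x inter_subset_right, sum_eq_single ∅]
  · simp
  · intro S hS hne
    have hS' := mem_powerset.1 hS
    refine apply_eq_zero_of_mem_zeroSet_sectionForms hx hq hJ
      (hS'.trans (inter_subset_left.trans hω)) ?_
    rw [inter_eq_right.2 (hS'.trans inter_subset_right)]
    exact nonempty_iff_ne_empty.2 hne
  · exact fun h => absurd (empty_mem_powerset _) h

variable [∀ i, Module (ZMod 2) (V i)]

/-- A form as a linear function of one of its variables. -/
def MultilinearOn.slice {I : Finset ι} {f : (∀ i, V i) → ZMod 2} (hf : MultilinearOn I f) {t : ι}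
    (ht : t ∈ I) (x : ∀ i, V i) : V t →ₗ[ZMod 2] ZMod 2 :=
  (AddMonoidHom.mk' (fun y => f (update x t y)) (hf.add t ht x)).toZModLinearMap 2

theorem MultilinearOn.slice_apply {I : Finset ι} {f : (∀ i, V i) → ZMod 2} (hf : MultilinearOn I f)
    {t : ι} (ht : t ∈ I) (x : ∀ i, V i) (y : V t) : hf.slice ht x y = f (update x t y) := rfl

/-- Expanding one variable in a basis. -/
theorem mem_productSpan_of_update [∀ i, Finite (V i)] {A : Finset ((∀ i, V i) → ZMod 2)}
    {I : Finset ι} {t : ι} (ht : t ∈ I) {f : (∀ i, V i) → ZMod 2} (hf : MultilinearOn I f)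
    (h : ∀ y, (fun x => f (update x t y)) ∈ productSpan A (I.erase t)) : f ∈ productSpan A I := by
  let e := Module.finBasis (ZMod 2) (V t)
  have hexp : f = ∑ j, fun x => e.repr (x t) j * f (update x t (e j)) := by
    funext x
    have h1 : f x = hf.slice ht x (x t) := by rw [hf.slice_apply, update_eq_self]
    rw [h1, Finset.sum_apply]
    conv_lhs => rw [← e.sum_repr (x t)]
    rw [map_sum]
    exact sum_congr rfl fun j _ => by rw [map_smul, hf.slice_apply, smul_eq_mul]
  rw [hexp]
  refine Submodule.sum_mem _ fun j _ => ?_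
  have key : ∀ g ∈ productSpan A (I.erase t),
      (fun x => e.repr (x t) j * g x) ∈ productSpan A I := by
    intro g hg
    induction hg using Submodule.span_induction with
    | mem g hg =>
      obtain ⟨a, ha, J, b, hJne, hJ, haJ, hb, rfl⟩ := hg
      have hcoord : MultilinearOn {t} (fun x : ∀ i, V i => e.repr (x t) j) :=
        ⟨fun x y hxy => by simp [hxy t (mem_singleton_self t)], fun i hi x c d => by
          obtain rfl := mem_singleton.1 hi
          simp⟩
      have htJ : t ∉ J := fun h => (mem_erase.1 (hJ h)).1 rfl
      refine Submodule.subset_span ⟨a, ha, J, fun x => e.repr (x t) j * b x, hJne,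
        hJ.trans (erase_subset _ _), haJ, ?_, ?_⟩
      · have := hcoord.mul hb (by simp)
        convert this using 1
        ext i
        by_cases hi : i = t
        · subst hi; simp [ht, htJ]
        · simp [hi]
      · funext x
        ring
    | zero =>
      convert (productSpan A I).zero_mem using 1
      funext x
      simp
    | add g g' _ _ hg hg' =>
      have := (productSpan A I).add_mem hg hg'
      convert this using 1
      funext x
      simp [mul_add]
    | smul c g _ hg =>
      have := (productSpan A I).smul_mem c hg
      convert this using 1
      funext x
      simp only [Pi.smul_apply, smul_eq_mul]
      ring
  exact key _ (h (e j))

/-- At `z`, the vectors `v ψ` are a dual system to the forms `ψ ∈ B` as functions of the variable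
`t`. -/
structure IsDualAt (t : ι) (z : ∀ i, V i) (v : ((∀ i, V i) → ZMod 2) → V t)
    (B : Finset ((∀ i, V i) → ZMod 2)) : Prop where
  one : ∀ ψ ∈ B, ψ (update z t (v ψ)) = 1
  zero : ∀ ψ ∈ B, ∀ χ ∈ B, ψ ≠ χ → ψ (update z t (v χ)) = 0

/-- The component of `y` in the kernel of all `ψ ∈ B`, given a dual system `v`. -/
def kernelPart {t : ι} (z : ∀ i, V i) (v : ((∀ i, V i) → ZMod 2) → V t)
    (B : Finset ((∀ i, V i) → ZMod 2)) (y : V t) : V t :=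
  y + ∑ χ ∈ B, χ (update z t y) • v χ

variable {t : ι} {z : ∀ i, V i} {v : ((∀ i, V i) → ZMod 2) → V t}
  {B : Finset ((∀ i, V i) → ZMod 2)}

theorem MultilinearOn.apply_kernelPart {J : Finset ι} {f : (∀ i, V i) → ZMod 2}
    (hf : MultilinearOn J f) (ht : t ∈ J) (y : V t) :
    f (update z t (kernelPart z v B y)) =
      f (update z t y) + ∑ χ ∈ B, χ (update z t y) * f (update z t (v χ)) := by
  simp only [← hf.slice_apply ht, kernelPart, map_add, map_sum, map_smul, smul_eq_mul]

theorem IsDualAt.apply_kernelPart (h : IsDualAt t z v B) {J : Finset ι} {ψ : (∀ i, V i) → ZMod 2}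
    (hψ : ψ ∈ B) (hJ : MultilinearOn J ψ) (ht : t ∈ J) (y : V t) :
    ψ (update z t (kernelPart z v B y)) = 0 := by
  rw [hJ.apply_kernelPart ht, sum_eq_single ψ, h.one ψ hψ, mul_one]
  · exact ZModModule.add_self _
  · intro χ hχ hne
    rw [h.zero ψ hψ χ hχ hne.symm, mul_zero]
  · exact fun h => absurd hψ h

end Vanishing

theorem sum_powerset_split {κ : Type*} [DecidableEq κ] {R : Type*} [AddCommMonoid R] {I K : Finset κ}
    (hK : K ⊆ I) (F : Finset κ → R) :
    ∑ ω ∈ I.powerset, F ω = ∑ ω₂ ∈ (I \ K).powerset, ∑ ω₁ ∈ K.powerset, F (ω₁ ∪ ω₂) := by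
  rw [← sum_product']
  refine sum_bij' (fun ω _ => (ω \ K, ω ∩ K)) (fun p _ => p.2 ∪ p.1) ?_ ?_ ?_ ?_ ?_
  · intro ω hω
    have := mem_powerset.1 hω
    exact mem_product.2 ⟨mem_powerset.2 (sdiff_subset_sdiff this subset_rfl),
      mem_powerset.2 inter_subset_right⟩
  · rintro ⟨a, b⟩ h
    obtain ⟨h1, h2⟩ := mem_product.1 h
    exact mem_powerset.2 (union_subset ((mem_powerset.1 h2).trans hK)
      ((mem_powerset.1 h1).trans sdiff_subset))
  · intro ω _
    ext i
    by_cases hi : i ∈ K <;> simp [hi]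
  · rintro ⟨a, b⟩ h
    obtain ⟨h1, h2⟩ := mem_product.1 h
    have h1 := mem_powerset.1 h1
    have h2 := mem_powerset.1 h2
    refine Prod.ext ?_ ?_
    · ext i
      have e1 := @h1 i
      have e2 := @h2 i
      simp only [mem_sdiff, mem_union] at *
      tauto
    · ext i
      have e1 := @h1 i
      have e2 := @h2 i
      simp only [mem_sdiff, mem_inter, mem_union] at *
      tauto
  · intro ω _
    congr 1
    ext i
    by_cases hi : i ∈ K <;> simp [hi]

section Vanishing

variable {ι : Type} [DecidableEq ι] {V : ι → Type}

open Classical in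
/-- The forms in `P'` together with the forms in `Pt` evaluated at the vectors `v χ`, `χ ∈ B`, in the
variable `t`. Their values tell whether a point is a common zero of `P'` and whether `v` is dual to
`B` there. -/
noncomputable def probeForms (Pt P' B : Finset ((∀ i, V i) → ZMod 2)) (t : ι)
    (v : ((∀ i, V i) → ZMod 2) → V t) : Finset ((∀ i, V i) → ZMod 2) :=
  P' ∪ (Pt ×ˢ B).image fun p x => p.1 (update x t (v p.2))

variable {Pt P' B : Finset ((∀ i, V i) → ZMod 2)} {t : ι} {v : ((∀ i, V i) → ZMod 2) → V t}

theorem card_probeForms_le : #(probeForms Pt P' B t v) ≤ #P' + #Pt * #B := by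
  classical
  refine (card_union_le _ _).trans (add_le_add le_rfl (card_image_le.trans ?_))
  rw [card_product]

theorem mem_probeForms_left {θ : (∀ i, V i) → ZMod 2} (h : θ ∈ P') :
    θ ∈ probeForms Pt P' B t v := by
  classical
  exact mem_union_left _ h

theorem mem_probeForms_right {ψ χ : (∀ i, V i) → ZMod 2} (hψ : ψ ∈ Pt) (hχ : χ ∈ B) :
    (fun x => ψ (update x t (v χ))) ∈ probeForms Pt P' B t v := by
  classical
  exact mem_union_right _ (mem_image.2 ⟨(ψ, χ), mem_product.2 ⟨hψ, hχ⟩, rfl⟩)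

variable [∀ i, AddCommGroup (V i)] [∀ i, Module (ZMod 2) (V i)]

/-- If the forms in `Pt` have a dual system in the variable `t` at a common zero `x₀` of `P'`, then a
form `φ` vanishing on the common zeros of `Pt` and `P'` equals, on the common zeros of the section
forms at `x₀`, an explicit combination of the `ψ ∈ Pt` with coefficients in the other variables. -/
theorem eq_sum_mul_of_isDualAt {I : Finset ι} (ht : t ∈ I) {x₀ : ∀ i, V i}
    (hP' : ∀ θ ∈ P', θ ∈ Forms V (I.erase t)) (hx₀ : x₀ ∈ zeroSet P')
    (hv : IsDualAt t x₀ v Pt) (J : ((∀ i, V i) → ZMod 2) → Finset ι)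
    (hJ : ∀ ψ ∈ Pt, t ∈ J ψ ∧ J ψ ⊆ I ∧ MultilinearOn (J ψ) ψ)
    {φ : (∀ i, V i) → ZMod 2} (hφ : MultilinearOn I φ)
    (hz : ∀ x, x ∈ zeroSet Pt → x ∈ zeroSet P' → φ x = 0) {x : ∀ i, V i}
    (hx : x ∈ zeroSet (sectionForms (probeForms Pt P' Pt t v) x₀ (I.erase t))) :
    φ x = ∑ ψ ∈ Pt, φ (update ((J ψ).piecewise x₀ x) t (v ψ)) * ψ x := by
  set z : Finset ι → ∀ i, V i := fun ω => ω.piecewise (x + x₀) x₀ with hzdef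
  have hprobe : ∀ ψ ∈ Pt, ∀ χ : (∀ i, V i) → ZMod 2,
      MultilinearOn ((J ψ).erase t) (fun x => ψ (update x t (v χ))) := fun ψ hψ χ =>
    (hJ ψ hψ).2.2.update_right t (v χ)
  -- At every vertex, the forms in `P'` vanish and `v` is dual to `Pt`.
  have hzP : ∀ ω ⊆ I.erase t, z ω ∈ zeroSet P' := by
    intro ω hω θ hθ
    obtain ⟨L, -, -, hL⟩ := hP' θ hθ
    rw [apply_vertex_eq hx (mem_probeForms_left hθ) hL hω]
    exact hx₀ θ hθ
  have hzv : ∀ ω ⊆ I.erase t, ∀ ψ ∈ Pt, ∀ χ ∈ Pt,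
      ψ (update (z ω) t (v χ)) = ψ (update x₀ t (v χ)) := fun ω hω ψ hψ χ hχ =>
    apply_vertex_eq hx (mem_probeForms_right hψ hχ) (hprobe ψ hψ χ) hω
  have hdual : ∀ ω ⊆ I.erase t, IsDualAt t (z ω) v Pt := fun ω hω =>
    ⟨fun ψ hψ => by rw [hzv ω hω ψ hψ ψ hψ, hv.one ψ hψ],
      fun ψ hψ χ hχ hne => by rw [hzv ω hω ψ hψ χ hχ, hv.zero ψ hψ χ hχ hne]⟩
  have hvertex : ∀ ω ⊆ I.erase t, ∀ y, φ (update (z ω) t y) =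
      ∑ ψ ∈ Pt, ψ (update (z ω) t y) * φ (update (z ω) t (v ψ)) := by
    intro ω hω y
    have h1 : φ (update (z ω) t (kernelPart (z ω) v Pt y)) = 0 :=
      hz _ (fun ψ hψ => (hdual ω hω).apply_kernelPart hψ (hJ ψ hψ).2.2 (hJ ψ hψ).1 y)
        (update_mem_zeroSet hP' (hzP ω hω) _)
    rw [hφ.apply_kernelPart ht] at h1
    have two : ∀ a b : ZMod 2, a + b = 0 → a = b := by decide
    exact two _ _ h1
  -- The coefficient of `ψ` does not change along the variables of `ψ`.
  have hstep : ∀ ψ ∈ Pt, ∀ i ∈ (J ψ).erase t, ∀ ω, insert i ω ⊆ I.erase t → i ∉ ω →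
      φ (update (z (insert i ω)) t (v ψ)) = φ (update (z ω) t (v ψ)) := by
    intro ψ hψ i hi ω hω hiω
    obtain ⟨hit, hiJ⟩ := mem_erase.1 hi
    have hiI : i ∈ I := (hJ ψ hψ).2.1 hiJ
    have hω' : ω ⊆ I.erase t := (subset_insert i ω).trans hω
    have hz1 : z (insert i ω) = update (z ω) i (x i + x₀ i) := by
      simp only [hzdef]
      rw [piecewise_insert]
      rfl
    have hz2 : update (z ω) i (x₀ i) = z ω := by
      rw [update_eq_self_iff]
      simp [hzdef, hiω]
    have hzero : ∀ q ∈ probeForms Pt P' Pt t v, ∀ L, MultilinearOn L q → (i ∈ L ∨ q x₀ = 0) →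
        q (update (z ω) i (x i)) = 0 := by
      intro q hq L hL hor
      have e1 := apply_vertex_eq hx hq hL hω
      have e2 := apply_vertex_eq hx hq hL hω'
      by_cases hiL : i ∈ L
      · change q (z (insert i ω)) = _ at e1
        change q (z ω) = _ at e2
        rw [hz1, hL.add i hiL, hz2, e2] at e1
        exact add_eq_right.1 e1
      · rw [hL.update_of_notMem hiL]
        exact e2.trans (hor.resolve_left hiL)
    have hnew : φ (update (update (z ω) i (x i)) t (v ψ)) = 0 := by
      apply hz
      · intro χ hχ
        refine hzero _ (mem_probeForms_right hχ hψ) _ (hprobe χ hχ ψ) ?_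
        by_cases hne : χ = ψ
        · left
          rw [hne]
          exact hi
        · right
          exact hv.zero χ hχ ψ hψ hne
      · refine update_mem_zeroSet hP' (fun θ hθ => ?_) _
        obtain ⟨L, -, -, hL⟩ := hP' θ hθ
        exact hzero θ (mem_probeForms_left hθ) L hL (Or.inr (hx₀ θ hθ))
    rw [hz1, update_comm hit, hφ.add i hiI, ← update_comm hit, hnew, zero_add, ← update_comm hit,
      hz2]
  have hcoeff : ∀ ψ ∈ Pt, ∀ ω ⊆ I.erase t, ∀ U ⊆ (J ψ).erase t,
      φ (update (z (U ∪ ω)) t (v ψ)) = φ (update (z ω) t (v ψ)) := by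
    intro ψ hψ ω hω U
    induction U using Finset.induction_on with
    | empty => simp
    | insert i U hiU ih =>
      intro hU
      have hU' := (subset_insert i U).trans hU
      rw [insert_union]
      by_cases hi : i ∈ U ∪ ω
      · rw [insert_eq_of_mem hi]
        exact ih hU'
      · rw [hstep ψ hψ i (hU (mem_insert_self i U)) _ _ hi, ih hU']
        rw [← insert_union]
        exact union_subset (hU.trans (erase_subset_erase t (hJ ψ hψ).2.1)) hω
  have hsum : φ x = ∑ ω ∈ (I.erase t).powerset, φ (update (z ω) t (x t)) := by
    rw [(hφ.update_right t (x t)).sum_vertices x x₀, update_eq_self]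
  rw [hsum, sum_congr rfl fun ω hω => hvertex ω (mem_powerset.1 hω) (x t), sum_comm]
  refine sum_congr rfl fun ψ hψ => ?_
  obtain ⟨htJ, hJI, hψJ⟩ := hJ ψ hψ
  rw [sum_powerset_split (erase_subset_erase t hJI)]
  have hterm : ∀ ω₂ ∈ (I.erase t \ (J ψ).erase t).powerset, ∀ ω₁ ∈ ((J ψ).erase t).powerset,
      ψ (update (z (ω₁ ∪ ω₂)) t (x t)) * φ (update (z (ω₁ ∪ ω₂)) t (v ψ)) =
        ψ (update (z ω₁) t (x t)) * φ (update (z ω₂) t (v ψ)) := by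
    intro ω₂ h2 ω₁ h1
    rw [mem_powerset] at h1 h2
    rw [hcoeff ψ hψ ω₂ (h2.trans sdiff_subset) ω₁ h1]
    congr 1
    refine (hψJ.update_right t (x t)).congr _ _ fun i hi => ?_
    have : i ∉ ω₂ := fun h => (mem_sdiff.1 (h2 h)).2 hi
    by_cases hi1 : i ∈ ω₁ <;> simp [hzdef, hi1, this]
  rw [sum_congr rfl fun ω₂ h2 => sum_congr rfl fun ω₁ h1 => hterm ω₂ h2 ω₁ h1]
  simp only [← sum_mul]
  rw [(hψJ.update_right t (x t)).sum_vertices x x₀, update_eq_self, ← mul_sum, mul_comm]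
  congr 1
  have hcof : MultilinearOn (I.erase t \ (J ψ).erase t)
      (fun w => φ (update ((J ψ).piecewise x₀ w) t (v ψ))) := by
    have h := (hφ.update_right t (v ψ)).piecewise_right (J ψ) x₀
    convert h using 1
    ext i
    simp only [mem_sdiff, mem_erase]
    by_cases hi : i = t <;> simp [hi]
  rw [← hcof.sum_vertices x x₀]
  refine sum_congr rfl fun ω₂ h2 => ?_
  congr 2
  funext i
  by_cases hi : i ∈ J ψ
  · have : i ∉ ω₂ := fun h => by
      have h' := mem_sdiff.1 (mem_powerset.1 h2 h)
      exact h'.2 (mem_erase.2 ⟨(mem_erase.1 h'.1).1, hi⟩)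
    simp [hzdef, hi, this]
  · simp [hzdef, hi]

end Vanishing

/-- For each `M`, the common zeros of `M` forms in at most `d` variables determine boundedly many
forms such that every form vanishing there is a combination of products with one of them as a
factor. -/
def VanishingBound (d : ℕ) : Prop :=
  ∀ M : ℕ, ∃ k : ℕ, ∀ (ι : Type) [DecidableEq ι] (V : ι → Type)
    [∀ i, AddCommGroup (V i)] [∀ i, Module (ZMod 2) (V i)] [∀ i, Finite (V i)]
    (I : Finset ι) (P : Finset ((∀ i, V i) → ZMod 2)), #I ≤ d → #P ≤ M →
    (∀ ψ ∈ P, ψ ∈ Forms V I) →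
    ∃ A : Finset ((∀ i, V i) → ZMod 2), #A ≤ k ∧ (∀ a ∈ A, a ∈ Forms V I) ∧
      ∀ φ : (∀ i, V i) → ZMod 2, MultilinearOn I φ → (∀ x ∈ zeroSet P, φ x = 0) →
        φ ∈ productSpan A I

/-- The variant of `VanishingBound` in which `m` bounds the number of forms that involve a
distinguished variable `t`. -/
def SplitVanishingBound (d m : ℕ) : Prop :=
  ∀ M : ℕ, ∃ k : ℕ, ∀ (ι : Type) [DecidableEq ι] (V : ι → Type)
    [∀ i, AddCommGroup (V i)] [∀ i, Module (ZMod 2) (V i)] [∀ i, Finite (V i)]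
    (I : Finset ι) (t : ι) (Pt P' : Finset ((∀ i, V i) → ZMod 2)), #I ≤ d → t ∈ I → #Pt ≤ m →
    #P' ≤ M → (∀ ψ ∈ Pt, ∃ J : Finset ι, t ∈ J ∧ J ⊆ I ∧ MultilinearOn J ψ) →
    (∀ θ ∈ P', θ ∈ Forms V (I.erase t)) →
    ∃ A : Finset ((∀ i, V i) → ZMod 2), #A ≤ k ∧ (∀ a ∈ A, a ∈ Forms V I) ∧
      ∀ φ : (∀ i, V i) → ZMod 2, MultilinearOn I φ →
        (∀ x, x ∈ zeroSet Pt → x ∈ zeroSet P' → φ x = 0) → φ ∈ productSpan A I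

section Vanishing

variable {ι : Type} [DecidableEq ι] {V : ι → Type} [∀ i, AddCommGroup (V i)]
  [∀ i, Module (ZMod 2) (V i)] {Pt P' B : Finset ((∀ i, V i) → ZMod 2)} {t : ι}
  {v : ((∀ i, V i) → ZMod 2) → V t}

/-- If a dual system to `B` cannot be extended to `insert ψ₀ B` at `z`, then `ψ₀` is there a
combination of the forms in `B`. -/
theorem IsDualAt.eq_sum {z : ∀ i, V i} (hv : IsDualAt t z v B) {ψ₀ : (∀ i, V i) → ZMod 2}
    (J : ((∀ i, V i) → ZMod 2) → Finset ι) (hJ₀ : t ∈ J ψ₀)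
    (hJ₀' : MultilinearOn (J ψ₀) ψ₀) (hJ : ∀ ψ ∈ B, t ∈ J ψ ∧ MultilinearOn (J ψ) ψ)
    {B' : Finset ((∀ i, V i) → ZMod 2)} (hB' : ∀ ψ ∈ B', ψ = ψ₀ ∨ ψ ∈ B)
    (hmax : ∀ w, ¬ IsDualAt t z w B') (y : V t) :
    ψ₀ (update z t y) = ∑ χ ∈ B, χ (update z t y) * ψ₀ (update z t (v χ)) := by
  classical
  by_contra hne
  set y' := kernelPart z v B y with hy'
  have h1 : ψ₀ (update z t y') = 1 := by
    have one : ∀ a b : ZMod 2, a ≠ b → a + b = 1 := by decide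
    rw [hy', hJ₀'.apply_kernelPart hJ₀]
    exact one _ _ hne
  have h0 : ∀ ψ ∈ B, ψ (update z t y') = 0 := fun ψ hψ =>
    hv.apply_kernelPart hψ (hJ ψ hψ).2 (hJ ψ hψ).1 y
  have hw : ∀ χ ∈ B, ∀ ψ, ∀ L, MultilinearOn L ψ → t ∈ L →
      ψ (update z t (v χ + ψ₀ (update z t (v χ)) • y')) =
        ψ (update z t (v χ)) + ψ₀ (update z t (v χ)) * ψ (update z t y') := by
    intro χ _ ψ L hL ht
    simp only [← hL.slice_apply ht, map_add, map_smul, smul_eq_mul]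
  have hval₀ : ∀ χ ∈ B, ψ₀ (update z t (v χ + ψ₀ (update z t (v χ)) • y')) = 0 := by
    intro χ hχ
    rw [hw χ hχ ψ₀ _ hJ₀' hJ₀, h1, mul_one]
    exact ZModModule.add_self _
  have hval : ∀ ψ ∈ B, ∀ χ ∈ B, ψ (update z t (v χ + ψ₀ (update z t (v χ)) • y')) =
      ψ (update z t (v χ)) := by
    intro ψ hψ χ hχ
    rw [hw χ hχ ψ _ (hJ ψ hψ).2 (hJ ψ hψ).1, h0 ψ hψ, mul_zero, add_zero]
  refine hmax (fun χ => if χ = ψ₀ then y' else v χ + ψ₀ (update z t (v χ)) • y') ⟨?_, ?_⟩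
  · intro ψ hψ
    by_cases h : ψ = ψ₀
    · simp only [h, if_true, h1]
    · have hψB := (hB' ψ hψ).resolve_left h
      simp only [h, if_false]
      rw [hval ψ hψB ψ hψB, hv.one ψ hψB]
  · intro ψ hψ χ hχ hne
    by_cases h : χ = ψ₀
    · have hψB := (hB' ψ hψ).resolve_left fun h' => hne (h'.trans h.symm)
      simp only [h, if_true, h0 ψ hψB]
    · have hχB := (hB' χ hχ).resolve_left h
      simp only [h, if_false]
      by_cases h' : ψ = ψ₀
      · rw [h', hval₀ χ hχB]
      · have hψB := (hB' ψ hψ).resolve_left h'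
        rw [hval ψ hψB χ hχB, hv.zero ψ hψB χ hχB hne]

/-- Summing a relation over a cube in the variables of a form of the largest size isolates the forms
with exactly these variables. -/
theorem sum_filter_eq_zero_of_relation {x₀ x : ∀ i, V i} {R : Finset ((∀ i, V i) → ZMod 2)}
    (J : ((∀ i, V i) → ZMod 2) → Finset ι) (hJ : ∀ ψ ∈ R, t ∈ J ψ ∧ MultilinearOn (J ψ) ψ)
    {ψ₁ : (∀ i, V i) → ZMod 2} (hmax : ∀ ψ ∈ R, #(J ψ) ≤ #(J ψ₁))
    (hrel : ∀ ω ⊆ (J ψ₁).erase t, ∀ y, ∑ ψ ∈ R, ψ (update (ω.piecewise (x + x₀) x₀) t y) = 0) :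
    ∑ ψ ∈ R with J ψ = J ψ₁, ψ x = 0 := by
  have h0 : ∑ ω ∈ ((J ψ₁).erase t).powerset, ∑ ψ ∈ R,
      ψ (update (ω.piecewise (x + x₀) x₀) t (x t)) = 0 :=
    sum_eq_zero fun ω hω => hrel ω (mem_powerset.1 hω) _
  rw [sum_comm] at h0
  rw [← h0, sum_filter]
  refine sum_congr rfl fun ψ hψ => ?_
  obtain ⟨htJ, hψJ⟩ := hJ ψ hψ
  have hslice := hψJ.update_right t (x t)
  split_ifs with h
  · rw [← h, hslice.sum_vertices x x₀, update_eq_self]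
  · have hnot : ¬ (J ψ₁).erase t ⊆ J ψ := fun hsub => by
      refine h (eq_of_subset_of_card_le ?_ (hmax ψ hψ)).symm
      intro i hi
      by_cases hit : i = t
      · rwa [hit]
      · exact hsub (mem_erase.2 ⟨hit, hi⟩)
    obtain ⟨i, hi, hiJ⟩ := not_subset.1 hnot
    rw [← insert_erase hi, sum_powerset_insert (notMem_erase i _), ← sum_add_distrib]
    refine (sum_eq_zero fun ω _ => ?_).symm
    have e : ψ (update ((insert i ω).piecewise (x + x₀) x₀) t (x t)) =
        ψ (update (ω.piecewise (x + x₀) x₀) t (x t)) := by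
      refine hslice.congr _ _ fun j hj => ?_
      have hji : j ≠ i := by
        rintro rfl
        exact hiJ (mem_erase.1 hj).2
      rw [piecewise_insert, update_of_ne hji]
    rw [e]
    exact ZModModule.add_self _

end Vanishing

/-- Take a maximal set `B ⊆ Pt` with a dual system at a common zero of `P'`. If `B = Pt`, then `φ` is
given by `eq_sum_mul_of_isDualAt` up to a form vanishing on a variety that does not involve `t`.
Otherwise one form of `Pt` can be replaced by boundedly many that do not involve `t`. -/
theorem SplitVanishingBound.zero_or_succ {d : ℕ} (hd : VanishingBound d) {m : ℕ}
    (hm : m = 0 ∨ SplitVanishingBound (d + 1) (m - 1)) : SplitVanishingBound (d + 1) m := by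
  classical
  intro M
  obtain ⟨k₁, hk₁⟩ := hd ((M + m * m) * 2 ^ d)
  obtain ⟨k₂, hk₂⟩ : ∃ k₂, m = 0 ∨ ∀ (ι : Type) [DecidableEq ι] (V : ι → Type)
    [∀ i, AddCommGroup (V i)] [∀ i, Module (ZMod 2) (V i)] [∀ i, Finite (V i)]
    (I : Finset ι) (t : ι) (Pt P' : Finset ((∀ i, V i) → ZMod 2)), #I ≤ d + 1 → t ∈ I →
    #Pt ≤ m - 1 → #P' ≤ M + k₁ → (∀ ψ ∈ Pt, ∃ J : Finset ι, t ∈ J ∧ J ⊆ I ∧ MultilinearOn J ψ) →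
    (∀ θ ∈ P', θ ∈ Forms V (I.erase t)) →
    ∃ A : Finset ((∀ i, V i) → ZMod 2), #A ≤ k₂ ∧ (∀ a ∈ A, a ∈ Forms V I) ∧
      ∀ φ : (∀ i, V i) → ZMod 2, MultilinearOn I φ →
        (∀ x, x ∈ zeroSet Pt → x ∈ zeroSet P' → φ x = 0) → φ ∈ productSpan A I := by
    rcases hm with rfl | hm
    · exact ⟨0, Or.inl rfl⟩
    · obtain ⟨k₂, hk₂⟩ := hm (M + k₁)
      exact ⟨k₂, Or.inr hk₂⟩
  refine ⟨m + k₁ + k₂, ?_⟩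
  intro ι _ V _ _ _ I t Pt P' hI ht hPt hP'M hPtf hP'f
  have hJ : ∀ ψ : (∀ i, V i) → ZMod 2, ∃ J : Finset ι, ψ ∈ Pt →
      t ∈ J ∧ J ⊆ I ∧ MultilinearOn J ψ := fun ψ => by
    by_cases h : ψ ∈ Pt
    · obtain ⟨J, hJ⟩ := hPtf ψ h
      exact ⟨J, fun _ => hJ⟩
    · exact ⟨∅, fun h' => absurd h' h⟩
  choose J hJ using hJ
  have hId : #(I.erase t) ≤ d := by
    rw [card_erase_of_mem ht]
    omega
  -- A maximal subset `B` of `Pt` having a dual system at some common zero of `P'`.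
  obtain ⟨B, hB, hBmax⟩ := exists_max_image
    (Pt.powerset.filter fun B => ∃ z ∈ zeroSet P', ∃ v, IsDualAt t z v B) card
    ⟨∅, mem_filter.2 ⟨empty_mem_powerset _, 0, zero_mem_zeroSet hP'f, 0,
      ⟨by simp, by simp⟩⟩⟩
  obtain ⟨hBPt, x₀, hx₀, v, hv⟩ := mem_filter.1 hB
  rw [mem_powerset] at hBPt
  have hcard : ∀ K ⊆ I.erase t,
      #(sectionForms (probeForms Pt P' B t v) x₀ K) ≤ (M + m * m) * 2 ^ d := fun K hK => by
    refine card_sectionForms_le.trans (Nat.mul_le_mul (card_probeForms_le.trans ?_) ?_)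
    · exact add_le_add hP'M (Nat.mul_le_mul hPt ((card_le_card hBPt).trans hPt))
    · exact Nat.pow_le_pow_right (by norm_num) ((card_le_card hK).trans hId)
  by_cases hBeq : B = Pt
  · subst hBeq
    obtain ⟨A, hAk, hAf, hA⟩ := hk₁ ι V (I.erase t) _ hId (hcard _ subset_rfl)
      fun ψ => mem_forms_of_mem_sectionForms
    refine ⟨B ∪ A, (card_union_le _ _).trans (by omega), ?_, ?_⟩
    · intro a ha
      rcases mem_union.1 ha with ha | ha
      · exact ⟨J a, ⟨t, (hJ a ha).1⟩, (hJ a ha).2⟩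
      · exact Forms.mono (erase_subset _ _) (hAf a ha)
    intro φ hφ hz
    have hcof : ∀ ψ ∈ B, MultilinearOn (I \ J ψ)
        (fun x => φ (update ((J ψ).piecewise x₀ x) t (v ψ))) := by
      intro ψ hψ
      have h := (hφ.update_right t (v ψ)).piecewise_right (J ψ) x₀
      convert h using 1
      ext i
      simp only [mem_sdiff, mem_erase]
      by_cases hi : i = t <;> simp [hi, (hJ ψ hψ).1]
    have hS : MultilinearOn I
        (fun x => ∑ ψ ∈ B, φ (update ((J ψ).piecewise x₀ x) t (v ψ)) * ψ x) := by
      refine MultilinearOn.sum B fun ψ hψ => ?_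
      have := (hcof ψ hψ).mul (hJ ψ hψ).2.2 sdiff_disjoint
      rwa [sdiff_union_of_subset (hJ ψ hψ).2.1] at this
    have hdiff := hφ.sub hS
    have h1 : (fun x => φ x - ∑ ψ ∈ B, φ (update ((J ψ).piecewise x₀ x) t (v ψ)) * ψ x) ∈
        productSpan A I := by
      refine mem_productSpan_of_update ht hdiff fun y => ?_
      refine hA _ (hdiff.update_right t y) fun x hx => ?_
      have hx' := update_mem_zeroSet (fun ψ hψ => mem_forms_of_mem_sectionForms hψ) hx y
      exact sub_eq_zero.2 (eq_sum_mul_of_isDualAt ht hP'f hx₀ hv J hJ hφ hz hx')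
    have h2 : (fun x => ∑ ψ ∈ B, φ (update ((J ψ).piecewise x₀ x) t (v ψ)) * ψ x) ∈
        productSpan B I := by
      have e : (fun x => ∑ ψ ∈ B, φ (update ((J ψ).piecewise x₀ x) t (v ψ)) * ψ x) =
          ∑ ψ ∈ B, fun x => ψ x * φ (update ((J ψ).piecewise x₀ x) t (v ψ)) := by
        funext x
        rw [Finset.sum_apply]
        exact sum_congr rfl fun ψ _ => mul_comm _ _
      rw [e]
      exact Submodule.sum_mem _ fun ψ hψ => Submodule.subset_span
        ⟨ψ, hψ, J ψ, _, ⟨t, (hJ ψ hψ).1⟩, (hJ ψ hψ).2.1, (hJ ψ hψ).2.2, hcof ψ hψ, rfl⟩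
    have h3 := (productSpan (B ∪ A) I).add_mem (productSpan_mono subset_union_right I h1)
      (productSpan_mono subset_union_left I h2)
    convert h3 using 1
    funext x
    simp
  · obtain ⟨ψ₀, hψ₀, hψ₀B⟩ := exists_of_ssubset (hBPt.ssubset_of_ne hBeq)
    have hm0 : m ≠ 0 := by
      have := card_pos.2 ⟨ψ₀, hψ₀⟩
      omega
    have hk₂ := hk₂.resolve_left hm0
    have hnodual : ∀ z ∈ zeroSet P', ∀ w, ¬ IsDualAt t z w (insert ψ₀ B) := by
      intro z hz w hw
      have := hBmax (insert ψ₀ B) (mem_filter.2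
        ⟨mem_powerset.2 (insert_subset hψ₀ hBPt), z, hz, w, hw⟩)
      rw [card_insert_of_notMem hψ₀B] at this
      omega
    set R := insert ψ₀ (B.filter fun ψ => ψ₀ (update x₀ t (v ψ)) = 1) with hR
    have hRPt : R ⊆ Pt := insert_subset hψ₀ ((filter_subset _ _).trans hBPt)
    have hψ₀R : ψ₀ ∉ B.filter fun ψ => ψ₀ (update x₀ t (v ψ)) = 1 := fun h =>
      hψ₀B (mem_filter.1 h).1
    obtain ⟨ψ₁, hψ₁, hmax⟩ := exists_max_image R (fun ψ => #(J ψ)) ⟨ψ₀, mem_insert_self _ _⟩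
    have hψ₁J := hJ ψ₁ (hRPt hψ₁)
    have hK : (J ψ₁).erase t ⊆ I.erase t := erase_subset_erase t hψ₁J.2.1
    -- At the vertices of the cubes the values of `Pt` on the `v χ` are those at `x₀`, and these
    -- determine the coefficients of the relation.
    have hrel : ∀ x ∈ zeroSet (sectionForms (probeForms Pt P' B t v) x₀ ((J ψ₁).erase t)),
        ∑ ψ ∈ R with J ψ = J ψ₁, ψ x = 0 := by
      intro x hx
      refine sum_filter_eq_zero_of_relation (t := t) (x₀ := x₀) J
        (fun ψ hψ => ⟨(hJ ψ (hRPt hψ)).1, (hJ ψ (hRPt hψ)).2.2⟩) hmax fun ω hω y => ?_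
      set z := ω.piecewise (x + x₀) x₀ with hzdef
      have hzP : z ∈ zeroSet P' := by
        intro θ hθ
        obtain ⟨L, -, -, hL⟩ := hP'f θ hθ
        rw [apply_vertex_eq hx (mem_probeForms_left hθ) hL hω]
        exact hx₀ θ hθ
      have hzv : ∀ ψ ∈ Pt, ∀ χ ∈ B, ψ (update z t (v χ)) = ψ (update x₀ t (v χ)) :=
        fun ψ hψ χ hχ => apply_vertex_eq hx (mem_probeForms_right hψ hχ)
          ((hJ ψ hψ).2.2.update_right t (v χ)) hω
      have hdual : IsDualAt t z v B :=
        ⟨fun ψ hψ => by rw [hzv ψ (hBPt hψ) ψ hψ, hv.one ψ hψ],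
          fun ψ hψ χ hχ hne => by rw [hzv ψ (hBPt hψ) χ hχ, hv.zero ψ hψ χ hχ hne]⟩
      have h := hdual.eq_sum J (hJ ψ₀ hψ₀).1 (hJ ψ₀ hψ₀).2.2
        (fun ψ hψ => ⟨(hJ ψ (hBPt hψ)).1, (hJ ψ (hBPt hψ)).2.2⟩)
        (B' := insert ψ₀ B) (fun ψ hψ => mem_insert.1 hψ) (hnodual z hzP) y
      rw [hR, sum_insert hψ₀R, h, sum_filter, ← sum_add_distrib]
      refine sum_eq_zero fun χ hχ => ?_
      rw [hzv ψ₀ hψ₀ χ hχ]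
      have : ∀ a b : ZMod 2, a * b + (if b = 1 then a else 0) = 0 := by decide
      exact this _ _
    obtain ⟨A', hA'k, hA'f, hA'⟩ := hk₁ ι V ((J ψ₁).erase t) _ ((card_le_card hK).trans hId)
      (hcard _ hK) fun ψ => mem_forms_of_mem_sectionForms
    have hfK : MultilinearOn (J ψ₁) (fun x => ∑ ψ ∈ R with J ψ = J ψ₁, ψ x) := by
      refine MultilinearOn.sum _ fun ψ hψ => ?_
      obtain ⟨hψR, hψJ⟩ := mem_filter.1 hψ
      rw [← hψJ]
      exact (hJ ψ (hRPt hψR)).2.2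
    have hspan : (fun x => ∑ ψ ∈ R with J ψ = J ψ₁, ψ x) ∈ productSpan A' (J ψ₁) := by
      refine mem_productSpan_of_update hψ₁J.1 hfK fun y => ?_
      refine hA' _ (hfK.update_right t y) fun x hx => ?_
      exact hrel _ (update_mem_zeroSet (fun ψ hψ => mem_forms_of_mem_sectionForms hψ) hx y)
    -- Modulo `A'`, the form `ψ₁` is a combination of others; `A'` does not involve `t`.
    obtain ⟨A, hAk, hAf, hA⟩ := hk₂ ι V I t (Pt.erase ψ₁) (P' ∪ A') hI ht
      (by rw [card_erase_of_mem (hRPt hψ₁)]; omega)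
      ((card_union_le _ _).trans (by omega))
      (fun ψ hψ => hPtf ψ (mem_of_mem_erase hψ))
      (fun θ hθ => by
        rcases mem_union.1 hθ with hθ | hθ
        · exact hP'f θ hθ
        · exact Forms.mono hK (hA'f θ hθ))
    refine ⟨A, by omega, hAf, fun φ hφ hz => hA φ hφ fun x hxt hx' => hz x ?_ ?_⟩
    · have hxA' : x ∈ zeroSet A' := fun a ha => hx' a (mem_union_right _ ha)
      have h1 : ∑ ψ ∈ R with J ψ = J ψ₁, ψ x = 0 := apply_eq_zero_of_mem_productSpan hspan hxA'
      have h2 : ψ₁ x = 0 := by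
        refine Eq.trans (Eq.symm ?_) h1
        refine sum_eq_single ψ₁ (fun ψ hψ hne => ?_) fun h => ?_
        · exact hxt ψ (mem_erase.2 ⟨hne, hRPt (mem_filter.1 hψ).1⟩)
        · exact (h (mem_filter.2 ⟨hψ₁, rfl⟩)).elim
      intro ψ hψ
      by_cases h : ψ = ψ₁
      · rw [h, h2]
      · exact hxt ψ (mem_erase.2 ⟨h, hψ⟩)
    · exact fun θ hθ => hx' θ (mem_union_left _ hθ)

theorem VanishingBound.split {d : ℕ} (hd : VanishingBound d) (m : ℕ) :
    SplitVanishingBound (d + 1) m := by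
  induction m with
  | zero => exact SplitVanishingBound.zero_or_succ hd (Or.inl rfl)
  | succ m ih => exact SplitVanishingBound.zero_or_succ hd (Or.inr ih)

theorem vanishingBound (d : ℕ) : VanishingBound d := by
  classical
  have hempty : ∀ (ι : Type) [DecidableEq ι] (V : ι → Type)
      [∀ i, AddCommGroup (V i)] [∀ i, Module (ZMod 2) (V i)]
      (P : Finset ((∀ i, V i) → ZMod 2)), (∀ ψ ∈ P, ψ ∈ Forms V ∅) →
      ∀ φ : (∀ i, V i) → ZMod 2, MultilinearOn ∅ φ → (∀ x ∈ zeroSet P, φ x = 0) →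
        φ ∈ productSpan ∅ ∅ := by
    intro ι _ V _ _ P hP φ hφ hz
    have : φ = 0 := by
      funext x
      rw [hφ.congr x 0 (by simp), hz 0 (zero_mem_zeroSet hP)]
      rfl
    rw [this]
    exact (productSpan ∅ ∅).zero_mem
  induction d with
  | zero =>
    intro M
    refine ⟨0, ?_⟩
    intro ι _ V _ _ _ I P hI _ hP
    obtain rfl : I = ∅ := by simpa using hI
    exact ⟨∅, by simp, by simp, hempty ι V P hP⟩
  | succ d ih =>
    intro M
    obtain ⟨k, hk⟩ := ih.split M M
    refine ⟨k, ?_⟩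
    intro ι _ V _ _ _ I P hI hPM hP
    rcases I.eq_empty_or_nonempty with rfl | ⟨t, ht⟩
    · exact ⟨∅, by simp, by simp, hempty ι V P hP⟩
    obtain ⟨A, hAk, hAf, hA⟩ := hk ι V I t
      (P.filter fun ψ => ∃ J : Finset ι, t ∈ J ∧ J ⊆ I ∧ MultilinearOn J ψ)
      (P.filter fun ψ => ψ ∈ Forms V (I.erase t)) hI ht
      ((card_filter_le _ _).trans hPM) ((card_filter_le _ _).trans hPM)
      (fun ψ hψ => (mem_filter.1 hψ).2) (fun ψ hψ => (mem_filter.1 hψ).2)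
    refine ⟨A, hAk, hAf, fun φ hφ hz => hA φ hφ fun x h1 h2 => hz x fun ψ hψ => ?_⟩
    obtain ⟨J, hJne, hJI, hJ⟩ := hP ψ hψ
    by_cases htJ : t ∈ J
    · exact h1 ψ (mem_filter.2 ⟨hψ, J, htJ, hJI, hJ⟩)
    · exact h2 ψ (mem_filter.2 ⟨hψ, J, hJne, subset_erase.2 ⟨hJI, htJ⟩, hJ⟩)

/-! ### Forms and tensors -/

section Tensor

variable {d : ℕ} {n : Fin d → ℕ}

instance : Finite (Tensors n) := Module.finite_of_finite (ZMod 2)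

instance (V : Submodule (ZMod 2) (Tensors n)) : Finite (Tensors n ⧸ V) :=
  Finite.of_surjective V.mkQ V.mkQ_surjective

/-- The map `u ↦ u₁ ⊗ ⋯ ⊗ u_d` modulo `V`. -/
theorem multilinearOn_mkQ_tprod (V : Submodule (ZMod 2) (Tensors n)) :
    MultilinearOn univ
      (fun u : (i : Fin d) → Vec (n i) => V.mkQ (PiTensorProduct.tprod (ZMod 2) u)) where
  congr x y hxy := by rw [funext fun i => hxy i (mem_univ i)]
  add i _ x a b := by rw [MultilinearMap.map_update_add, map_add]

theorem card_vec_le {m : ℕ} (hm : m ≠ 0) :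
    Nat.card (Vec m) ≤ 2 * Nat.card {v : Vec m // v ≠ 0} := by
  classical
  have h1 : Nat.card {v : Vec m // v ≠ 0} = Nat.card (Vec m) - 1 := by
    rw [Nat.card_eq_fintype_card, Nat.card_eq_fintype_card]
    exact Set.card_ne_eq (0 : Vec m)
  have : NeZero m := ⟨hm⟩
  have h2 : 1 < Nat.card (Vec m) := Finite.one_lt_card
  omega

/-- In an `η`-closed subspace, the rank one tensors are dense, also among all tuples instead of the
nonzero ones. -/
theorem dens_tprod_mem_of_isEtaClosed {η : ℝ} (hη : 0 < η) {V : Submodule (ZMod 2) (Tensors n)}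
    (hV : IsEtaClosed η (V : Set (Tensors n))) :
    min η 1 / 2 ^ d ≤
      dens {u : (i : Fin d) → Vec (n i) | V.mkQ (PiTensorProduct.tprod (ZMod 2) u) = 0} := by
  have h2d : (1 : ℝ) ≤ 2 ^ d := one_le_pow₀ (by norm_num)
  simp only [Submodule.mkQ_apply, Submodule.Quotient.mk_eq_zero]
  set T : Set ((i : Fin d) → Vec (n i)) := {u | PiTensorProduct.tprod (ZMod 2) u ∈ V} with hT
  by_cases h0 : ∃ i, n i = 0
  · obtain ⟨i, hi⟩ := h0
    have huniv : T = Set.univ := by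
      refine Set.eq_univ_of_forall fun u => ?_
      have hui : u i = 0 := by
        funext j
        exact absurd j.2 (by omega)
      change PiTensorProduct.tprod (ZMod 2) u ∈ V
      rw [MultilinearMap.map_coord_zero _ i hui]
      exact V.zero_mem
    have : Nonempty ((i : Fin d) → Vec (n i)) := ⟨0⟩
    rw [huniv, dens_univ, div_le_one (by positivity)]
    exact (min_le_right _ _).trans h2d
  push Not at h0
  have hVpos : (0 : ℝ) < Nat.card V := by exact_mod_cast Nat.card_pos
  have e : {p : ↥(V : Set (Tensors n)) × NonzeroTuple n //
      (p.1 : Tensors n) + PiTensorProduct.tprod (ZMod 2) (fun i => (p.2 i : Vec (n i))) ∈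
        (V : Set (Tensors n))} ≃
      V × {u : NonzeroTuple n // (fun i => (u i : Vec (n i))) ∈ T} :=
    { toFun := fun p => (p.1.1, ⟨p.1.2, (V.add_mem_iff_right p.1.1.2).1 p.2⟩)
      invFun := fun p => ⟨(p.1, p.2.1), (V.add_mem_iff_right p.1.2).2 p.2.2⟩
      left_inv := fun p => rfl
      right_inv := fun p => rfl }
  have h1 : η * Nat.card (NonzeroTuple n) ≤
      Nat.card {u : NonzeroTuple n // (fun i => (u i : Vec (n i))) ∈ T} := by
    have h := hV
    rw [IsEtaClosed, Nat.card_congr e, Nat.card_prod, Nat.card_prod] at h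
    push_cast at h
    refine le_of_mul_le_mul_left ?_ hVpos
    calc _ = η * ((Nat.card V : ℝ) * Nat.card (NonzeroTuple n)) := by ring
      _ ≤ _ := h
  have h2 : Nat.card {u : NonzeroTuple n // (fun i => (u i : Vec (n i))) ∈ T} ≤ T.ncard := by
    rw [← Nat.card_coe_set_eq]
    refine Nat.card_le_card_of_injective
      (fun u => (⟨fun i => (u.1 i : Vec (n i)), u.2⟩ : T)) fun u w huw => ?_
    apply Subtype.ext
    funext i
    exact Subtype.ext (congrFun (congrArg Subtype.val huw) i)
  have h3 : Nat.card ((i : Fin d) → Vec (n i)) ≤ 2 ^ d * Nat.card (NonzeroTuple n) := by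
    rw [Nat.card_pi, Nat.card_pi]
    calc ∏ i, Nat.card (Vec (n i)) ≤ ∏ i, 2 * Nat.card {v : Vec (n i) // v ≠ 0} :=
          prod_le_prod' fun i _ => card_vec_le (h0 i)
      _ = _ := by rw [prod_mul_distrib]; simp
  have hX : (0 : ℝ) < Fintype.card ((i : Fin d) → Vec (n i)) := by exact_mod_cast Fintype.card_pos
  rw [Nat.card_eq_fintype_card] at h3
  have h3' : (Fintype.card ((i : Fin d) → Vec (n i)) : ℝ) ≤ 2 ^ d * Nat.card (NonzeroTuple n) := by
    exact_mod_cast h3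
  have h2' : (Nat.card {u : NonzeroTuple n // (fun i => (u i : Vec (n i))) ∈ T} : ℝ) ≤ T.ncard := by
    exact_mod_cast h2
  rw [dens_eq_ncard, div_le_div_iff₀ (by positivity) hX]
  calc min η 1 * (Fintype.card ((i : Fin d) → Vec (n i)) : ℝ)
      ≤ η * (2 ^ d * Nat.card (NonzeroTuple n)) := by
        gcongr
        exact min_le_left _ _
    _ = η * Nat.card (NonzeroTuple n) * 2 ^ d := by ring
    _ ≤ T.ncard * 2 ^ d := by
        gcongr
        exact h1.trans h2'

/-- A form in the variables satisfying `p` is a linear functional on their tensor product. -/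
theorem MultilinearOn.exists_linear {p : Fin d → Prop} [DecidablePred p] {K : Finset (Fin d)}
    (hp : ∀ i, i ∈ K ↔ p i) {f : ((i : Fin d) → Vec (n i)) → ZMod 2} (hf : MultilinearOn K f) :
    ∃ l : (⨂[ZMod 2] i : {i : Fin d // p i}, Vec (n i)) →ₗ[ZMod 2] ZMod 2,
      ∀ u : (i : Fin d) → Vec (n i),
        l (PiTensorProduct.tprod (ZMod 2) (fun i : {i : Fin d // p i} => u i)) = f u := by
  let ext : ((i : {i : Fin d // p i}) → Vec (n i)) → (i : Fin d) → Vec (n i) :=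
    fun w i => if h : p i then w ⟨i, h⟩ else 0
  have hext : ∀ w i c, ext (update w i c) = update (ext w) i.1 c := by
    intro w i c
    funext j
    by_cases hj : j = i.1
    · subst hj
      simp [ext, i.2]
    · by_cases hpj : p j
      · have : (⟨j, hpj⟩ : {i : Fin d // p i}) ≠ i := fun h => hj (congrArg Subtype.val h)
        simp [ext, hpj, hj, this]
      · simp [ext, hpj, hj]
  let m : MultilinearMap (ZMod 2) (fun i : {i : Fin d // p i} => Vec (n i)) (ZMod 2) :=
    MultilinearMap.mk' (fun w => f (ext w))
      (fun w i a b => by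
        simp only [hext]
        exact hf.add i.1 ((hp i.1).2 i.2) _ a b)
      (fun w i c a => by
        simp only [hext, ← hf.slice_apply ((hp i.1).2 i.2)]
        exact map_smul _ c a)
  refine ⟨PiTensorProduct.lift m, fun u => ?_⟩
  rw [PiTensorProduct.lift.tprod]
  refine hf.congr _ _ fun i hi => ?_
  simp [ext, (hp i).1 hi]

open Classical in
/-- The functional on `𝔽₂^J` given by a form in the variables `J`; zero for other functions. -/
noncomputable def functionalOn (J : Finset (Fin d)) (a : ((i : Fin d) → Vec (n i)) → ZMod 2) :
    TensorsOn n J →ₗ[ZMod 2] ZMod 2 :=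
  if h : MultilinearOn J a then (h.exists_linear (p := (· ∈ J)) fun _ => Iff.rfl).choose else 0

theorem functionalOn_tprod {J : Finset (Fin d)} {a : ((i : Fin d) → Vec (n i)) → ZMod 2}
    (h : MultilinearOn J a) (u : (i : Fin d) → Vec (n i)) :
    functionalOn J a (PiTensorProduct.tprod (ZMod 2) (fun i : {i : Fin d // i ∈ J} => u i)) =
      a u := by
  rw [functionalOn, dif_pos h]
  exact (h.exists_linear (p := (· ∈ J)) fun _ => Iff.rfl).choose_spec u

/-- The subspace of `𝔽₂^J` on which all forms of `A` in the variables `J` vanish. -/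
noncomputable def annihilatorOn (A : Finset (((i : Fin d) → Vec (n i)) → ZMod 2))
    (J : Finset (Fin d)) : Submodule (ZMod 2) (TensorsOn n J) :=
  LinearMap.ker (LinearMap.pi fun a : A => functionalOn J a.1)

theorem finrank_quotient_annihilatorOn_le (A : Finset (((i : Fin d) → Vec (n i)) → ZMod 2))
    (J : Finset (Fin d)) :
    Module.finrank (ZMod 2) (TensorsOn n J ⧸ annihilatorOn A J) ≤ #A := by
  rw [annihilatorOn, (LinearMap.quotKerEquivRange _).finrank_eq]
  refine (Submodule.finrank_le _).trans ?_
  simp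

/-- A combination of products with a factor in `A`, as a functional on tensors, vanishes on the
simple subspace defined by `A`. -/
theorem exists_functional_of_mem_productSpan {A : Finset (((i : Fin d) → Vec (n i)) → ZMod 2)}
    {f : ((i : Fin d) → Vec (n i)) → ZMod 2} (hf : f ∈ productSpan A univ) :
    ∃ l : Tensors n →ₗ[ZMod 2] ZMod 2, (∀ u, l (PiTensorProduct.tprod (ZMod 2) u) = f u) ∧
      ∀ w ∈ ⨅ (I : Finset (Fin d)) (_ : I.Nonempty), extend I (annihilatorOn A I), l w = 0 := by
  induction hf using Submodule.span_induction with
  | mem f hf =>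
    obtain ⟨a, ha, J, b, hJ, -, haJ, hb, rfl⟩ := hf
    obtain ⟨lb, hlb⟩ := hb.exists_linear (p := (· ∉ J)) (by simp)
    refine ⟨(LinearMap.mul' (ZMod 2) (ZMod 2) ∘ₗ TensorProduct.map (functionalOn J a) lb) ∘ₗ
      (splitEquiv n J).symm.toLinearMap, fun u => ?_, fun w hw => ?_⟩
    · rw [← splitEquiv_tprod n J u]
      simp only [LinearMap.comp_apply, LinearEquiv.coe_coe, LinearEquiv.symm_apply_apply,
        TensorProduct.map_tmul, LinearMap.mul'_apply]
      rw [functionalOn_tprod haJ, hlb]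
    · have hw' : w ∈ extend J (annihilatorOn A J) :=
        (Submodule.mem_iInf _).1 ((Submodule.mem_iInf _).1 hw J) hJ
      obtain ⟨_, ⟨z, rfl⟩, rfl⟩ := hw'
      have hzero : functionalOn J a ∘ₗ (annihilatorOn A J).subtype = 0 := by
        ext y
        have hy : (LinearMap.pi fun a : A => functionalOn J a.1) y.1 = 0 := LinearMap.mem_ker.1 y.2
        exact congrFun hy ⟨a, ha⟩
      have hcomp : TensorProduct.map (functionalOn J a) lb ∘ₗ
          LinearMap.rTensor (TensorsOff n J) (annihilatorOn A J).subtype = 0 := by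
        rw [LinearMap.map_comp_rTensor, hzero, TensorProduct.map_zero_left]
      simp only [LinearMap.comp_apply, LinearEquiv.coe_coe, LinearEquiv.symm_apply_apply]
      have := LinearMap.congr_fun hcomp z
      rw [LinearMap.comp_apply] at this
      rw [this]
      simp
  | zero => exact ⟨0, by simp, by simp⟩
  | add f g _ _ hf hg =>
    obtain ⟨l, h1, h2⟩ := hf
    obtain ⟨l', h1', h2'⟩ := hg
    exact ⟨l + l', fun u => by simp [h1, h1'], fun w hw => by simp [h2 w hw, h2' w hw]⟩
  | smul c f _ hf =>
    obtain ⟨l, h1, h2⟩ := hf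
    exact ⟨c • l, fun u => by simp [h1], fun w hw => by simp [h2 w hw]⟩

end Tensor
end TensorClosed

open TensorClosed in
theorem corollary2p7 (d : ℕ) (hd : 0 < d) (η : ℝ) (hη : 0 < η) :
    ∃ k : ℕ, ∀ (n : Fin d → ℕ) (V : Submodule (ZMod 2) (TensorClosed.Tensors n)),
      TensorClosed.IsEtaClosed η (V : Set (TensorClosed.Tensors n)) →
        ∃ W : Submodule (ZMod 2) (TensorClosed.Tensors n),
          TensorClosed.IsSimpleSubspace k W ∧ W ≤ V := by
  obtain ⟨M, hM⟩ := denseZeroBound d (min η 1 / 2 ^ d) (by positivity)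
  obtain ⟨k, hk⟩ := vanishingBound d M
  refine ⟨k, fun n V hV => ?_⟩
  obtain ⟨P, hPM, hPf, hPz⟩ := hM (Fin d) (fun i => Vec (n i)) (Tensors n ⧸ V) Finset.univ _
    (by simp) (multilinearOn_mkQ_tprod V) (dens_tprod_mem_of_isEtaClosed hη hV)
  obtain ⟨A, hAk, -, hA⟩ := hk (Fin d) (fun i => Vec (n i)) Finset.univ P (by simp) hPM hPf
  refine ⟨_, ⟨annihilatorOn A, fun I _ =>
    (finrank_quotient_annihilatorOn_le A I).trans hAk, rfl⟩, fun w hw => ?_⟩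
  rw [← Submodule.Quotient.mk_eq_zero, ← Module.forall_dual_apply_eq_zero_iff (ZMod 2)]
  intro l
  obtain ⟨l', h1, h2⟩ := exists_functional_of_mem_productSpan
    (hA _ ((multilinearOn_mkQ_tprod V).comp l.toAddMonoidHom) fun u hu => by
      have : V.mkQ (PiTensorProduct.tprod (ZMod 2) u) = 0 := hPz hu
      rw [this, map_zero])
  have hl : l' = l ∘ₗ V.mkQ := PiTensorProduct.ext (MultilinearMap.ext h1)
  rw [← h2 w hw, hl]
  rfl
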